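/- **Setting.** Let $\Omega\subset\mathbb R^3$ be a bounded open set with smooth boundary $\Gamma=\partial\Omega$, and let $a\in C^1(\overline\Omega)$ satisfy $0<a_0\le a(x)\le a_1$ on $\overline\Omega$ for constants $a_0,a_1$. Let $f,g:\mathbb R\to\mathbb R$ be of class $C^2$ such that, for $j=f$ and $j=g$, $$\limsup_{|t|\to\infty}\frac{j(t)}{t}\le 0,\qquad |j(u)|+|j'(u)|+|j''(u)|\le K\quad\text{for all }u\in\mathbb R,$$ with some constant $K>0$. Fix $\tfrac12<s<1$ and let $H^{-s}(\Omega)=(H^s(\Omega))'$. Let $\gamma$ denote the trace on $\Gamma$. For $u,w\in H^1(\Omega)$ define $\Lambda u$, $\tilde F_0(u)$ and $D\tilde F_0(u)w$ by $$\langle\Lambda u,v\rangle=\int_\Omega a\nabla u\cdot\nabla v\,dx+\int_\Omega uv\,dx,\qquad \langle\tilde F_0(u),v\rangle=\int_\Omega f(u)v\,dx+\int_\Gamma g(\gamma u)\,\gamma v\,dS,$$ $$\langle D\tilde F_0(u)w,v\rangle=\int_\Omega f'(u)wv\,dx+\int_\Gamma g'(\gamma u)\,\gamma w\,\gamma v\,dS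 .$$ Here $v\in H^1(\Omega)$; the functionals $\tilde F_0(u)$ and $D\tilde F_0(u)w$ extend uniquely to elements of $H^{-s}(\Omega)$. A solution of the limit elliptic problem $$-\mathrm{div}(a\nabla u)+u=f(u)\ \text{ in }\Omega,\qquad a\,\frac{\partial u}{\partial\vec n}=g(u)\ \text{ on }\Gamma$$ is a $u\in H^1(\Omega)$ with $\Lambda u=\tilde F_0(u)$. For $u_0^*\in H^1(\Omega)$, the spectrum $\sigma(\Lambda-D\tilde F_0(u_0^*))$ is that of the unbounded operator $u\mapsto\Lambda u-D\tilde F_0(u_0^*)u$ in $H^{-s}(\Omega)$ with domain $\{u\in H^1(\Omega):\Lambda u\in H^{-s}(\Omega)\}$. **Theorem.** If $u_0^*$ is a solution of the limit elliptic problem and $0\notin\sigma(\Lambda-D\tilde F_0(u_0^*))$, then $u_0^*$ is isolated: there is $r>0$ such that $u_0^*$ is the only solution $u$ of the limit elliptic problem with $\|u-u_0^*\|_{H^1(\Omega)}\le r$. -/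

import Mathlib

open MeasureTheory Filter Topology
open scoped ContDiff RealInnerProductSpace ENNReal

namespace ConcentratedWave

/-- The space `ℝ³` with its Euclidean norm. -/
abbrev E3 : Type := EuclideanSpace ℝ (Fin 3)

/-- `Ω` has a smooth (`C^∞`) boundary: near every boundary point, after a rigid change of axes,
`Ω` is the region strictly above the graph of a smooth function of two variables. -/
def HasSmoothBoundary (Ω : Set E3) : Prop :=
  ∀ x ∈ frontier Ω, ∃ (R : E3 ≃ₗᵢ[ℝ] E3) (h : EuclideanSpace ℝ (Fin 2) → ℝ) (r : ℝ),
    ContDiff ℝ ∞ h ∧ 0 < r ∧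
      ∀ y ∈ Metric.ball x r, y ∈ Ω ↔ h !₂[(R y) 0, (R y) 1] < (R y) 2

/-- `|j| + |j'| + |j''| ≤ K`, `j ∈ C²`, and `limsup_{|s| → ∞} j(s)/s ≤ 0`
(the upper limit is taken in the extended reals). -/
structure IsAdmissible (j : ℝ → ℝ) : Prop where
  contDiff : ContDiff ℝ 2 j
  dissipative : limsup (fun s : ℝ => ((j s / s : ℝ) : EReal)) (Bornology.cobounded ℝ) ≤ 0
  bounded : ∃ K : ℝ, 0 < K ∧ ∀ u : ℝ, |j u| + |deriv j u| + |deriv (deriv j) u| ≤ K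

/-! ### Sobolev spaces on `Ω` -/

/-- Lebesgue measure on `Ω`. -/
noncomputable abbrev vol (Ω : Set E3) : Measure E3 := volume.restrict Ω

/-- `G` is the weak gradient of `u` in `Ω`: `∫_Ω u ∂_e φ = -∫_Ω (G · e) φ` for every direction `e`
and every test function `φ ∈ C_c^∞(Ω)`. -/
def IsWeakGradient (Ω : Set E3) (u : E3 → ℝ) (G : E3 → E3) : Prop :=
  ∀ φ : E3 → ℝ, ContDiff ℝ ∞ φ → HasCompactSupport φ → tsupport φ ⊆ Ω → ∀ e : E3,
    ∫ x in Ω, u x * fderiv ℝ φ x e = - ∫ x in Ω, ⟪G x, e⟫ * φ x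

theorem integrable_mul_of_test {Ω : Set E3} {p : E3 → ℝ} (hp : MemLp p 2 (vol Ω)) {ψ : E3 → ℝ}
    (hψ : Continuous ψ) (hc : HasCompactSupport ψ) : Integrable (fun x => p x * ψ x) (vol Ω) :=
  have h : MemLp ψ 2 (vol Ω) := hψ.memLp_of_hasCompactSupport hc
  hp.integrable_mul h

theorem memLp_inner_const {Ω : Set E3} {G : E3 → E3} (hG : MemLp G 2 (vol Ω)) (e : E3) :
    MemLp (fun x => ⟪G x, e⟫) 2 (vol Ω) :=
  hG.inner_const e

theorem continuous_fderiv_test {φ : E3 → ℝ} (h : ContDiff ℝ ∞ φ) (e : E3) :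
    Continuous fun x => fderiv ℝ φ x e :=
  (h.continuous_fderiv (by simp)).clm_apply continuous_const

theorem hasCompactSupport_fderiv_test {φ : E3 → ℝ} (h : HasCompactSupport φ) (e : E3) :
    HasCompactSupport fun x => fderiv ℝ φ x e :=
  h.fderiv_apply (𝕜 := ℝ) e

/-- The Sobolev space `H¹(Ω)`: the pairs `(u, ∇u) ∈ L²(Ω) × L²(Ω; ℝ³)` with `∇u` the weak gradient
of `u`. The norm inherited from the product is `(‖u‖² + ‖∇u‖²)^(1/2)`. -/
noncomputable def H1 (Ω : Set E3) :
    Submodule ℝ (WithLp 2 (Lp ℝ 2 (vol Ω) × Lp E3 2 (vol Ω))) where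
  carrier := {p | IsWeakGradient Ω p.fst p.snd}
  zero_mem' := by
    intro φ _ _ _ e
    have h1 : ∀ᵐ x ∂(vol Ω), (0 : Lp ℝ 2 (vol Ω)) x * fderiv ℝ φ x e = 0 := by
      filter_upwards [Lp.coeFn_zero ℝ 2 (vol Ω)] with x hx
      rw [hx, Pi.zero_apply, zero_mul]
    have h2 : ∀ᵐ x ∂(vol Ω), ⟪(0 : Lp E3 2 (vol Ω)) x, e⟫ * φ x = 0 := by
      filter_upwards [Lp.coeFn_zero E3 2 (vol Ω)] with x hx
      rw [hx, Pi.zero_apply, inner_zero_left, zero_mul]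
    have e1 := integral_congr_ae h1
    have e2 := integral_congr_ae h2
    simp only [integral_zero] at e1 e2
    simp only [WithLp.zero_fst, WithLp.zero_snd]
    rw [e1, e2, neg_zero]
  add_mem' := by
    intro p q hp hq φ h1 h2 h3 e
    have ep := hp φ h1 h2 h3 e
    have eq := hq φ h1 h2 h3 e
    have a1 : ∫ x in Ω, (p + q).fst x * fderiv ℝ φ x e
        = ∫ x in Ω, (p.fst x * fderiv ℝ φ x e + q.fst x * fderiv ℝ φ x e) := by
      refine integral_congr_ae ?_
      filter_upwards [Lp.coeFn_add p.fst q.fst] with x hx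
      rw [WithLp.add_fst, hx, Pi.add_apply, add_mul]
    have a2 : ∫ x in Ω, ⟪(p + q).snd x, e⟫ * φ x
        = ∫ x in Ω, (⟪p.snd x, e⟫ * φ x + ⟪q.snd x, e⟫ * φ x) := by
      refine integral_congr_ae ?_
      filter_upwards [Lp.coeFn_add p.snd q.snd] with x hx
      simp only [WithLp.add_snd, hx, Pi.add_apply, inner_add_left, add_mul]
    have c := continuous_fderiv_test h1 e
    have d := hasCompactSupport_fderiv_test h2 e
    rw [a1, a2, integral_add (integrable_mul_of_test (Lp.memLp p.fst) c d)
        (integrable_mul_of_test (Lp.memLp q.fst) c d),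
      integral_add (integrable_mul_of_test (memLp_inner_const (Lp.memLp p.snd) e) h1.continuous h2)
        (integrable_mul_of_test (memLp_inner_const (Lp.memLp q.snd) e) h1.continuous h2), ep, eq]
    ring
  smul_mem' := by
    intro c p hp φ h1 h2 h3 e
    have ep := hp φ h1 h2 h3 e
    have a1 : ∫ x in Ω, (c • p).fst x * fderiv ℝ φ x e
        = ∫ x in Ω, c * (p.fst x * fderiv ℝ φ x e) := by
      refine integral_congr_ae ?_
      filter_upwards [Lp.coeFn_smul c p.fst] with x hx
      rw [WithLp.smul_fst, hx, Pi.smul_apply, smul_eq_mul, mul_assoc]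
    have a2 : ∫ x in Ω, ⟪(c • p).snd x, e⟫ * φ x
        = ∫ x in Ω, c * (⟪p.snd x, e⟫ * φ x) := by
      refine integral_congr_ae ?_
      filter_upwards [Lp.coeFn_smul c p.snd] with x hx
      simp only [WithLp.smul_snd, hx, Pi.smul_apply, real_inner_smul_left, mul_assoc]
    rw [a1, a2, integral_const_mul, integral_const_mul, ep]
    ring

variable {Ω : Set E3}

/-- The class in `L²(Ω)` underlying an element of `H¹(Ω)`. -/
noncomputable def fn (u : H1 Ω) : Lp ℝ 2 (vol Ω) := u.1.fst

/-- The weak gradient of an element of `H¹(Ω)`. -/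
noncomputable def grad (u : H1 Ω) : Lp E3 2 (vol Ω) := u.1.snd

/-- The fractional Sobolev space `H^s(Ω)`, `0 < s < 1`: the functions `u ∈ L²(Ω)` for which
`(x, y) ↦ (u(x) - u(y)) / |x - y|^(3/2 + s)` is in `L²(Ω × Ω)`, paired with that quotient.
The norm inherited from the product is
`(‖u‖² + ∬ |u(x) - u(y)|² / |x - y|^(3 + 2s) dx dy)^(1/2)`. -/
noncomputable def Hs (Ω : Set E3) (s : ℝ) :
    Submodule ℝ (WithLp 2 (Lp ℝ 2 (vol Ω) × Lp ℝ 2 ((vol Ω).prod (vol Ω)))) where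
  carrier := {p | p.snd =ᵐ[(vol Ω).prod (vol Ω)]
    fun z => (p.fst z.1 - p.fst z.2) / ‖z.1 - z.2‖ ^ (3 / 2 + s)}
  zero_mem' := by
    have h := Lp.coeFn_zero ℝ 2 (vol Ω)
    have ha := Measure.quasiMeasurePreserving_fst (μ := vol Ω) (ν := vol Ω) |>.ae h
    have hb := Measure.quasiMeasurePreserving_snd (μ := vol Ω) (ν := vol Ω) |>.ae h
    filter_upwards [Lp.coeFn_zero ℝ 2 ((vol Ω).prod (vol Ω)), ha, hb] with z h0 h1 h2
    rw [WithLp.zero_snd, WithLp.zero_fst, h0, h1, h2]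
    simp
  add_mem' := by
    intro p q hp hq
    change _ =ᵐ[_] _ at hp hq ⊢
    have h := Lp.coeFn_add p.fst q.fst
    have ha := Measure.quasiMeasurePreserving_fst (μ := vol Ω) (ν := vol Ω) |>.ae h
    have hb := Measure.quasiMeasurePreserving_snd (μ := vol Ω) (ν := vol Ω) |>.ae h
    filter_upwards [Lp.coeFn_add p.snd q.snd, ha, hb, hp, hq] with z h0 h1 h2 h3 h4
    simp only [WithLp.add_snd, WithLp.add_fst, h0, h1, h2, Pi.add_apply, h3, h4]
    ring
  smul_mem' := by
    intro c p hp
    change _ =ᵐ[_] _ at hp ⊢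
    have h := Lp.coeFn_smul c p.fst
    have ha := Measure.quasiMeasurePreserving_fst (μ := vol Ω) (ν := vol Ω) |>.ae h
    have hb := Measure.quasiMeasurePreserving_snd (μ := vol Ω) (ν := vol Ω) |>.ae h
    filter_upwards [Lp.coeFn_smul c p.snd, ha, hb, hp] with z h0 h1 h2 h3
    simp only [WithLp.smul_snd, WithLp.smul_fst, h0, h1, h2, Pi.smul_apply, h3, smul_eq_mul]
    ring

/-- The class in `L²(Ω)` underlying an element of `H^s(Ω)`, as a continuous linear map. -/
noncomputable def fnHs {s : ℝ} : Hs Ω s →L[ℝ] Lp ℝ 2 (vol Ω) :=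
  (WithLp.fstL 2 ℝ (Lp ℝ 2 (vol Ω)) (Lp ℝ 2 ((vol Ω).prod (vol Ω)))).comp (Hs Ω s).subtypeL

/-- `H^{-s}(Ω)`, the dual of `H^s(Ω)`, with the dual norm. -/
abbrev Hneg (Ω : Set E3) (s : ℝ) : Type := StrongDual ℝ (Hs Ω s)

/-- The embedding `H¹(Ω) → H^{-s}(Ω)` through the pivot space `L²(Ω)`: `⟨u, φ⟩ = ∫_Ω u φ dx`. -/
noncomputable def toHneg (s : ℝ) (u : H1 Ω) : Hneg Ω s :=
  (innerSL ℝ (fn u)).comp fnHs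

/-! ### The trace on `Γ = ∂Ω` -/

/-- Surface measure `dS` on `Γ = ∂Ω` (two-dimensional Hausdorff measure, normalized so that it
agrees with Lebesgue measure on planes). -/
noncomputable def surface (Ω : Set E3) : Measure E3 :=
  (Measure.euclideanHausdorffMeasure 2 : Measure E3).restrict (frontier Ω)

/-- `ψ` is the trace of `u`: there are `φₙ`, smooth up to the boundary, with `φₙ → u` in `H¹(Ω)`
and `φₙ|_Γ → ψ` in `L²(Γ)`. -/
def IsTrace (u : H1 Ω) (ψ : Lp ℝ 2 (surface Ω)) : Prop :=
  ∃ φ : ℕ → E3 → ℝ, (∀ n, ContDiff ℝ ∞ (φ n)) ∧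
    Tendsto (fun n => eLpNorm (fun x => φ n x - fn u x) 2 (vol Ω)) atTop (𝓝 0) ∧
    Tendsto (fun n => eLpNorm (fun x => gradient (φ n) x - grad u x) 2 (vol Ω)) atTop (𝓝 0) ∧
    Tendsto (fun n => eLpNorm (fun x => φ n x - ψ x) 2 (surface Ω)) atTop (𝓝 0)

open Classical in
/-- The trace operator `γ : H¹(Ω) → L²(Γ)`, the extension by continuity of the restriction
`φ ↦ φ|_Γ`. For a bounded smooth `Ω` every `u ∈ H¹(Ω)` has exactly one trace. -/
noncomputable def trace (u : H1 Ω) : Lp ℝ 2 (surface Ω) :=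
  if h : ∃ ψ, IsTrace u ψ then h.choose else 0

/-! ### The limit elliptic problem -/

/-- `⟨Λ u, v⟩ = ∫_Ω a ∇u · ∇v dx + ∫_Ω u v dx`. -/
noncomputable def lamPair (a : E3 → ℝ) (u v : H1 Ω) : ℝ :=
  (∫ x in Ω, a x * ⟪grad u x, grad v x⟫) + (∫ x in Ω, fn u x * fn v x)

/-- `⟨F̃₀(u), v⟩ = ∫_Ω f(u) v dx + ∫_Γ g(u) v dS`. -/
noncomputable def F0Pair (f g : ℝ → ℝ) (u v : H1 Ω) : ℝ :=
  (∫ x in Ω, f (fn u x) * fn v x) + (∫ x, g (trace u x) * trace v x ∂(surface Ω))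

/-- `⟨DF̃₀(u) w, v⟩ = ∫_Ω f'(u) w v dx + ∫_Γ g'(u) w v dS`. -/
noncomputable def DF0Pair (f g : ℝ → ℝ) (u w v : H1 Ω) : ℝ :=
  (∫ x in Ω, deriv f (fn u x) * fn w x * fn v x)
    + (∫ x, deriv g (trace u x) * trace w x * trace v x ∂(surface Ω))

/-- The set `𝓔₀` of solutions of the limit problem: the `u ∈ H¹(Ω)` with `Λ u = F̃₀(u)`. -/
def equilibria (Ω : Set E3) (a : E3 → ℝ) (f g : ℝ → ℝ) : Set (H1 Ω) :=
  {u | ∀ v : H1 Ω, lamPair a u v = F0Pair f g u v}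

/-! ### The linearized operator and its spectrum -/

/-- The graph of the realization of `Λ - DF̃₀(u₀)` as an unbounded operator in `H^{-s}(Ω)`. Its
domain consists of the `u ∈ H¹(Ω)`, embedded in `H^{-s}(Ω)`, for which `Λ u - DF̃₀(u₀) u`, a priori
a functional on `H¹(Ω)`, is the restriction to `H¹(Ω) ⊂ H^s(Ω)` of some `ℓ ∈ H^{-s}(Ω)`; the value
is `ℓ`. -/
def linearizedGraph (Ω : Set E3) (s : ℝ) (a : E3 → ℝ) (f g : ℝ → ℝ) (u₀ : H1 Ω) :
    Set (Hneg Ω s × Hneg Ω s) :=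
  {p | ∃ u : H1 Ω, p.1 = toHneg s u ∧
    ∀ (v : H1 Ω) (φ : Hs Ω s), fnHs φ = fn v →
      lamPair a u v - DF0Pair f g u₀ u v = p.2 φ}

/-- The real points of the resolvent set of the (unbounded) operator `T` in `X` with graph `G`:
those `z` for which `T - z` has an everywhere defined bounded inverse `R`, that is,
`(x, y) ∈ G ↔ x = R (y - z x)`. -/
def resolventPoints {X : Type*} [NormedAddCommGroup X] [NormedSpace ℝ X] (G : Set (X × X)) :
    Set ℝ :=
  {z | ∃ R : X →L[ℝ] X, ∀ x y : X, (x, y) ∈ G ↔ x = R (y - z • x)}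

/-- The real points of the spectrum of the operator with graph `G`. (A real number lies in the
spectrum of a real operator if and only if it lies in that of its complexification.) -/
def spectralPoints {X : Type*} [NormedAddCommGroup X] [NormedSpace ℝ X] (G : Set (X × X)) :
    Set ℝ :=
  (resolventPoints G)ᶜ

end ConcentratedWave

/-!
The proof is by compactness. Suppose there were solutions `u₀ + wₙ ≠ u₀` with `wₙ → 0` in `H¹(Ω)`.
The normalized increments `zₙ = wₙ / ‖wₙ‖` have a subsequence converging weakly in `H¹(Ω)` to some
`ζ` (`exists_weak_limit`). For a fixed `v ∈ H¹(Ω)`, the `C²` bounds on `f` and `g` and dominated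
convergence show that `⟨Λ zₙ - DF̃₀(u₀) zₙ, v⟩ → 0` (`tendsto_linearized_div`), and
`u ↦ ⟨Λ u - DF̃₀(u₀) u, v⟩` is a continuous functional on `H¹(Ω)`, so `Λ ζ = DF̃₀(u₀) ζ` as
functionals on `H¹(Ω)`. Hence `(ζ, 0)` lies in the graph of the linearized operator in `H^{-s}(Ω)`,
and the bounded inverse at `0` gives `ζ = 0` (`fn_eq_zero_of_linearized`; test functions belong to
`H^s(Ω)`, so that an element of `H¹(Ω)` vanishing in `H^{-s}(Ω)` is zero). By Rellich's theorem
`zₙ → 0` strongly in `L²(Ω)`, and then the energy estimate `c ‖zₙ‖² ≤ D ‖zₙ‖²_{L²}`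
(`exists_energy_bound`) contradicts `‖zₙ‖ = 1`. This route needs the spectral hypothesis only through
the triviality of the kernel, and neither a trace theorem on `H^s(Ω)` nor Sobolev embeddings.

The function space theory on `Ω` rests on two facts about the boundary, a local graph. First, every
point of the closure has a neighbourhood in which `Ω` contains the cones of a fixed opening and
direction with vertex in `Ω` (`exists_interior_cone`). Averages over kernels shifted into these cones
see only values inside `Ω`; with a partition of unity they give the density in `H¹(Ω)` of functions
smooth on all of space (`exists_smooth_approx`), and they approximate functions with bounded gradient
uniformly, which yields Rellich's theorem (`tendsto_norm_fn_of_weakly_null`). Second, the surface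
measure slid inward is dominated by Lebesgue measure on `Ω` (`exists_slide_bound`), because the graph
parametrization is Lipschitz and Hausdorff measure scales accordingly. The fundamental theorem of
calculus along the sliding direction then gives the trace inequality
`‖γ u‖² ≤ C_ε ‖u‖² + ε ‖∇u‖²` (`exists_norm_trace_sq_le`), first for smooth functions and by density
on `H¹(Ω)`. It shows that the trace exists, is unique and linear, and it controls the boundary term
in the energy estimate.
-/

namespace ConcentratedWave

/-! ### The domain near its boundary -/

/-- The first two coordinates of a point of `ℝ³`. -/
noncomputable def horiz (p : E3) : EuclideanSpace ℝ (Fin 2) := !₂[p 0, p 1]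

theorem horiz_add (p q : E3) : horiz (p + q) = horiz p + horiz q := by
  ext i; fin_cases i <;> simp [horiz]

theorem horiz_sub (p q : E3) : horiz (p - q) = horiz p - horiz q := by
  ext i; fin_cases i <;> simp [horiz]

theorem norm_horiz_le (p : E3) : ‖horiz p‖ ≤ ‖p‖ := by
  rw [EuclideanSpace.norm_eq, EuclideanSpace.norm_eq]
  apply Real.sqrt_le_sqrt
  simp only [Fin.sum_univ_two, Fin.sum_univ_three, horiz]
  simp
  positivity

theorem continuous_horiz : Continuous horiz := by
  unfold horiz; fun_prop

/-- The vertical unit vector. -/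
noncomputable def vert : E3 := EuclideanSpace.single 2 1

theorem norm_vert : ‖vert‖ = 1 := by simp [vert]

theorem horiz_smul_vert (t : ℝ) : horiz (t • vert) = 0 := by
  ext i; fin_cases i <;> simp [horiz, vert]

theorem vert_two : vert 2 = 1 := by simp [vert]

theorem abs_coord_le (p : E3) : |p 2| ≤ ‖p‖ := by
  simpa using PiLp.norm_apply_le p 2

/-- Iterated integration: first over vertical lines, then over the horizontal plane. -/
theorem lintegral_horiz_vert (F : E3 → ℝ≥0∞) (hF : Measurable F) :
    ∫⁻ q : EuclideanSpace ℝ (Fin 2), ∫⁻ s : ℝ, F !₂[q 0, q 1, s] = ∫⁻ p : E3, F p := by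
  have e1 := (PiLp.volume_preserving_toLp (Fin 3)).lintegral_comp hF
  have e2 := (volume_preserving_piFinSuccAbove (fun _ : Fin 3 => ℝ) (Fin.last 2)).symm.lintegral_comp
    (hF.comp (PiLp.volume_preserving_toLp (Fin 3)).measurable)
  simp only [Function.comp_def] at e2
  rw [← e1, ← e2]
  have hm : Measurable fun z : ℝ × (Fin 2 → ℝ) => F (WithLp.toLp 2
      ((MeasurableEquiv.piFinSuccAbove (fun _ : Fin 3 => ℝ) (Fin.last 2)).symm z)) :=
    (hF.comp (PiLp.volume_preserving_toLp (Fin 3)).measurable).comp (MeasurableEquiv.measurable _)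
  have e3 := lintegral_prod_symm' (μ := (volume : Measure ℝ)) (ν := (volume : Measure (Fin 2 → ℝ)))
    _ hm
  refine Eq.trans ?_ e3.symm
  have e4 := (PiLp.volume_preserving_ofLp (Fin 2)).lintegral_comp
    (Measurable.lintegral_prod_left' (μ := (volume : Measure ℝ)) hm)
  refine Eq.trans ?_ e4
  refine lintegral_congr fun q => lintegral_congr fun s => ?_
  congr 1
  ext i
  fin_cases i <;> rfl


section Graph

variable {Ω : Set E3}

/-- `Ω` is, inside the ball of radius `r` about `x`, the region above the graph of `h` in the axes
given by `R`. -/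
def IsGraphAt (Ω : Set E3) (x : E3) (R : E3 ≃ₗᵢ[ℝ] E3) (h : EuclideanSpace ℝ (Fin 2) → ℝ)
    (r : ℝ) : Prop :=
  ContDiff ℝ ∞ h ∧ 0 < r ∧ ∀ y ∈ Metric.ball x r, y ∈ Ω ↔ h (horiz (R y)) < (R y) 2

theorem IsGraphAt.le_of_mem_closure {x : E3} {R : E3 ≃ₗᵢ[ℝ] E3}
    {h : EuclideanSpace ℝ (Fin 2) → ℝ} {r : ℝ} (H : IsGraphAt Ω x R h r) {y : E3}
    (hy : y ∈ Metric.ball x r) (hyΩ : y ∈ closure Ω) : h (horiz (R y)) ≤ (R y) 2 := by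
  obtain ⟨hh, -, H⟩ := H
  have h1 : y ∈ closure (Metric.ball x r ∩ Ω) := Metric.isOpen_ball.inter_closure ⟨hy, hyΩ⟩
  have hc : IsClosed {z : E3 | h (horiz (R z)) ≤ (R z) 2} := by
    refine isClosed_le (hh.continuous.comp (continuous_horiz.comp R.continuous)) ?_
    exact (EuclideanSpace.proj (𝕜 := ℝ) (2 : Fin 3)).continuous.comp R.continuous
  refine closure_minimal ?_ hc h1
  rintro z ⟨hz, hzΩ⟩
  exact ((H z hz).1 hzΩ).le

theorem IsGraphAt.eq_of_mem_frontier (hΩ : IsOpen Ω) {x : E3} {R : E3 ≃ₗᵢ[ℝ] E3}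
    {h : EuclideanSpace ℝ (Fin 2) → ℝ} {r : ℝ} (H : IsGraphAt Ω x R h r) {y : E3}
    (hy : y ∈ Metric.ball x r) (hyΩ : y ∈ frontier Ω) : h (horiz (R y)) = (R y) 2 := by
  refine le_antisymm (H.le_of_mem_closure hy (frontier_subset_closure hyΩ)) ?_
  rw [hΩ.frontier_eq] at hyΩ
  exact not_lt.1 fun h' => hyΩ.2 ((H.2.2 y hy).2 h')

/-- Near the centre of a graph chart, the points reached from the closure of `Ω` by an upward step
perturbed by a small multiple of its length lie in `Ω`; the opening is dictated by the Lipschitz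
constant of `h`. Vertices on the boundary are allowed. -/
theorem IsGraphAt.exists_cone {x : E3} {R : E3 ≃ₗᵢ[ℝ] E3}
    {h : EuclideanSpace ℝ (Fin 2) → ℝ} {r : ℝ} (H : IsGraphAt Ω x R h r) :
    ∃ (K : NNReal) (c ρ : ℝ), 0 < c ∧ 0 < ρ ∧ ρ ≤ r ∧
      LipschitzOnWith K h (Metric.ball (horiz (R x)) ρ) ∧
      ∀ y ∈ closure Ω ∩ Metric.ball x ρ, ∀ t ∈ Set.Ioo 0 ρ,
        ∀ v ∈ Metric.closedBall (t • R.symm vert) (c * t), y + v ∈ Ω := by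
  obtain ⟨K, U, hU, hK⟩ := ((H.1.of_le (by simp)).contDiffAt (x := horiz (R x))).exists_lipschitzOnWith
  obtain ⟨δ, hδ, hδU⟩ := Metric.mem_nhds_iff.1 hU
  have hK0 : (0 : ℝ) ≤ K := K.2
  -- a horizontal error `c * t` raises the graph by at most `K * c * t`, and `c + K * c < 1`
  set c : ℝ := 1 / (2 * (K + 1)) with hc
  have hc0 : 0 < c := by positivity
  have hcK : (K + 1) * c = 1 / 2 := by rw [hc]; field_simp
  have hc1 : c ≤ 1 := by nlinarith
  have hr := H.2.1
  set ρ : ℝ := min r δ / 4 with hρ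
  have hρ0 : 0 < ρ := by positivity
  have hρr : 4 * ρ ≤ r := by have := min_le_left r δ; linarith
  have hρδ : 4 * ρ ≤ δ := by have := min_le_right r δ; linarith
  refine ⟨K, c, ρ, hc0, hρ0, by linarith, hK.mono ((Metric.ball_subset_ball (by linarith)).trans hδU), ?_⟩
  rintro y ⟨hyc, hyb⟩ t ⟨ht0, htρ⟩ v hv
  rw [Metric.mem_ball, dist_eq_norm] at hyb
  rw [Metric.mem_closedBall, dist_eq_norm] at hv
  set w := v - t • R.symm vert with hw
  have hvw : v = t • R.symm vert + w := by rw [hw]; abel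
  have hRw : ‖R w‖ ≤ c * t := by rw [R.norm_map]; exact hv
  have hvn : ‖v‖ ≤ 2 * ρ := by
    rw [hvw]
    refine (norm_add_le _ _).trans ?_
    rw [norm_smul, R.symm.norm_map, norm_vert, Real.norm_of_nonneg ht0.le]
    nlinarith
  have hyv : ‖y + v - x‖ < 3 * ρ := by
    rw [show y + v - x = (y - x) + v by abel]
    exact (norm_add_le _ _).trans_lt (by linarith)
  have hRv : R v = t • vert + R w := by rw [hvw, map_add, map_smul, R.apply_symm_apply]
  refine (H.2.2 _ ?_).2 ?_
  · rw [Metric.mem_ball, dist_eq_norm]; linarith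
  have h1 := H.le_of_mem_closure (y := y) (by rw [Metric.mem_ball, dist_eq_norm]; linarith) hyc
  have hd (z : E3) (hz : ‖z - x‖ < 3 * ρ) : horiz (R z) ∈ U := by
    apply hδU
    rw [Metric.mem_ball, dist_eq_norm, ← horiz_sub, ← map_sub]
    refine (norm_horiz_le _).trans_lt ?_
    rw [R.norm_map]; linarith
  have h2 := hK.dist_le_mul _ (hd (y + v) hyv) _ (hd y (by linarith))
  have h3 : dist (horiz (R (y + v))) (horiz (R y)) ≤ c * t := by
    rw [dist_eq_norm, ← horiz_sub, map_add, add_sub_cancel_left, hRv, horiz_add, horiz_smul_vert,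
      zero_add]
    exact (norm_horiz_le _).trans hRw
  have h4 : h (horiz (R (y + v))) ≤ h (horiz (R y)) + K * (c * t) := by
    have := (le_abs_self _).trans (Real.dist_eq _ _ ▸ h2)
    have := mul_le_mul_of_nonneg_left h3 hK0
    linarith
  have h5 : (R (y + v)) 2 = (R y) 2 + t + (R w) 2 := by
    rw [map_add, hRv]
    simp [vert_two]; ring
  have h6 := (neg_abs_le ((R w) 2)).trans' (neg_le_neg ((abs_coord_le (R w)).trans hRw))
  rw [h5]
  nlinarith

/-- The uniform interior cone property, at all points of the closure: at interior points the cone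
degenerates to a ball. -/
theorem exists_interior_cone (hΩ : IsOpen Ω) (hΩs : HasSmoothBoundary Ω) (x : E3)
    (hx : x ∈ closure Ω) :
    ∃ (e : E3) (c ρ : ℝ), 0 < c ∧ 0 < ρ ∧
      ∀ y ∈ Ω ∩ Metric.ball x ρ, ∀ t ∈ Set.Ioo 0 ρ,
        ∀ v ∈ Metric.closedBall (t • e) (c * t), y + v ∈ Ω := by
  by_cases hxΩ : x ∈ Ω
  · obtain ⟨r, hr, hrΩ⟩ := Metric.isOpen_iff.1 hΩ x hxΩ
    refine ⟨0, 1, r / 2, one_pos, by positivity, ?_⟩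
    rintro y ⟨-, hy⟩ t ⟨ht0, ht⟩ v hv
    apply hrΩ
    simp only [smul_zero, one_mul, Metric.mem_closedBall, dist_zero_right] at hv
    rw [Metric.mem_ball, dist_eq_norm] at hy ⊢
    rw [show y + v - x = (y - x) + v by abel]
    exact (norm_add_le _ _).trans_lt (by linarith)
  · obtain ⟨R, h, r, H⟩ := hΩs x (by rw [hΩ.frontier_eq]; exact ⟨hx, hxΩ⟩)
    obtain ⟨K, c, ρ, hc, hρ, -, -, hcone⟩ := IsGraphAt.exists_cone (x := x) H
    exact ⟨_, c, ρ, hc, hρ, fun y hy => hcone y ⟨subset_closure hy.1, hy.2⟩⟩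

/-- Near a boundary point the surface measure, slid inward over a time `τ`, is dominated by
Lebesgue measure on `Ω`. -/
theorem exists_slide_bound (hΩ : IsOpen Ω) (hΩs : HasSmoothBoundary Ω) (x : E3)
    (hx : x ∈ frontier Ω) :
    ∃ (e : E3) (ρ : ℝ) (C : NNReal), 0 < ρ ∧ ∀ F : E3 → ℝ≥0∞, Measurable F →
      ∫⁻ y in Metric.ball x ρ, (∫⁻ t in Set.Ioo 0 ρ, F (y + t • e)) ∂(surface Ω)
        ≤ C * ∫⁻ y in Ω, F y := by
  obtain ⟨R, h, r, H'⟩ := hΩs x hx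
  have H : IsGraphAt Ω x R h r := H'
  obtain ⟨K, c, ρ, hc, hρ, hρr, hK, hcone⟩ := H.exists_cone
  set e := R.symm vert with he
  -- the graph parametrization of the boundary
  let G : EuclideanSpace ℝ (Fin 2) → E3 := fun q => R.symm !₂[q 0, q 1, h q]
  have hGc : Continuous G := by
    have : Continuous h := H.1.continuous
    refine R.symm.continuous.comp ?_
    fun_prop
  set D := Metric.ball (horiz (R x)) ρ with hD
  have hGL : LipschitzOnWith (1 + K) G D := by
    refine LipschitzOnWith.of_dist_le_mul fun p hp q hq => ?_
    have h1 := hK.dist_le_mul p hp q hq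
    rw [R.symm.dist_map]
    have h2 : dist (!₂[p 0, p 1, h p] : E3) !₂[q 0, q 1, h q] ≤ dist p q + dist (h p) (h q) := by
      rw [EuclideanSpace.dist_eq, EuclideanSpace.dist_eq p q]
      apply Real.sqrt_le_iff.2 ⟨by positivity, ?_⟩
      rw [add_sq, Real.sq_sqrt (by positivity)]
      simp only [Fin.sum_univ_three, Fin.sum_univ_two]
      simp
      positivity
    rw [NNReal.coe_add, NNReal.coe_one, add_mul, one_mul]
    linarith
  set S := frontier Ω ∩ Metric.ball x ρ with hS
  have hSG : ∀ y ∈ S, y = G (horiz (R y)) ∧ horiz (R y) ∈ D := by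
    rintro y ⟨hy, hyb⟩
    have h1 := H.eq_of_mem_frontier hΩ (Metric.ball_subset_ball hρr hyb) hy
    constructor
    · rw [R.eq_symm_apply, h1]
      ext i; fin_cases i <;> simp [horiz]
    · rw [Metric.mem_ball, dist_eq_norm] at hyb ⊢
      rw [← horiz_sub, ← map_sub]
      exact (norm_horiz_le _).trans_lt (by rwa [R.norm_map])
  -- the factor normalizing the Hausdorff measure is the same on the plane and on space
  set k : NNReal := (volume.addHaarScalarFactor (Measure.hausdorffMeasure ((2 : ℕ) : ℝ) :
    Measure (EuclideanSpace ℝ (Fin 2)))) with hk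
  have hmeas : (surface Ω).restrict (Metric.ball x ρ) ≤
      ((1 + K) ^ 2 : NNReal) • Measure.map G volume := by
    refine Measure.le_iff.2 fun A hA => ?_
    rw [surface, Measure.restrict_restrict Metric.isOpen_ball.measurableSet,
      Measure.restrict_apply hA, Measure.smul_apply, Measure.map_apply hGc.measurable hA,
      Set.inter_comm (Metric.ball x ρ), ← hS]
    have h1 : A ∩ S ⊆ G '' (G ⁻¹' A ∩ D) := by
      rintro y ⟨hyA, hyS⟩
      obtain ⟨h1, h2⟩ := hSG y hyS
      exact ⟨_, ⟨by rw [Set.mem_preimage, ← h1]; exact hyA, h2⟩, h1.symm⟩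
    refine (measure_mono h1).trans ?_
    have h2 := (hGL.mono (Set.inter_subset_right (s := G ⁻¹' A))).hausdorffMeasure_image_le
      (d := ((2 : ℕ) : ℝ)) (by positivity)
    rw [← EuclideanSpace.euclideanHausdorffMeasure_eq_volume 2, Measure.euclideanHausdorffMeasure_def,
      Measure.euclideanHausdorffMeasure_def, Measure.smul_apply, Measure.smul_apply]
    calc _ ≤ k • (((1 + K : NNReal) : ℝ≥0∞) ^ ((2 : ℕ) : ℝ)
          * Measure.hausdorffMeasure ((2 : ℕ) : ℝ) (G ⁻¹' A ∩ D)) := by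
            gcongr
      _ = ((1 + K) ^ 2 : NNReal) • (k • Measure.hausdorffMeasure ((2 : ℕ) : ℝ) (G ⁻¹' A ∩ D)) := by
            simp only [ENNReal.smul_def, smul_eq_mul]
            rw [ENNReal.rpow_natCast]; push_cast; ring
      _ ≤ _ := by gcongr; exact Set.inter_subset_left
  refine ⟨e, ρ, (1 + K) ^ 2, hρ, fun F hF => ?_⟩
  set F' := Ω.indicator F with hF'
  have hF'm : Measurable F' := hF.indicator hΩ.measurableSet
  have hadd : ∀ q (t : ℝ), G q + t • e = R.symm !₂[q 0, q 1, t + h q] := by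
    intro q t
    rw [he, ← map_smul, ← map_add]
    congr 1
    ext i; fin_cases i <;> simp [vert, add_comm]
  calc ∫⁻ y in Metric.ball x ρ, (∫⁻ t in Set.Ioo 0 ρ, F (y + t • e)) ∂(surface Ω)
      = ∫⁻ y in Metric.ball x ρ, (∫⁻ t in Set.Ioo 0 ρ, F' (y + t • e)) ∂(surface Ω) := by
        rw [surface, Measure.restrict_restrict Metric.isOpen_ball.measurableSet]
        refine setLIntegral_congr_fun
          (Metric.isOpen_ball.measurableSet.inter isClosed_frontier.measurableSet) fun y hy => ?_
        refine setLIntegral_congr_fun measurableSet_Ioo fun t ht => ?_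
        rw [hF', Set.indicator_of_mem]
        refine hcone y ⟨frontier_subset_closure hy.2, hy.1⟩ t ht _ ?_
        exact Metric.mem_closedBall_self (by have := ht.1; positivity)
    _ ≤ ∫⁻ y in Metric.ball x ρ, (∫⁻ t : ℝ, F' (y + t • e)) ∂(surface Ω) := by
        exact lintegral_mono fun y => setLIntegral_le_lintegral _ _
    _ ≤ ∫⁻ y, (∫⁻ t : ℝ, F' (y + t • e)) ∂(((1 + K) ^ 2 : NNReal) • Measure.map G volume) :=
        lintegral_mono' hmeas le_rfl
    _ = ((1 + K) ^ 2 : NNReal) * ∫⁻ q, ∫⁻ t, F' (G q + t • e) := by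
        have hm : Measurable fun y : E3 => ∫⁻ t : ℝ, F' (y + t • e) :=
          Measurable.lintegral_prod_right' (f := fun z : E3 × ℝ => F' (z.1 + z.2 • e))
            (hF'm.comp (by fun_prop))
        rw [lintegral_smul_measure, lintegral_map hm hGc.measurable]
        rfl
    _ = ((1 + K) ^ 2 : NNReal) * ∫⁻ y in Ω, F y := by
        -- on each vertical line the shift by `h q` leaves the integral unchanged
        congr 1
        rw [← lintegral_indicator hΩ.measurableSet, ← hF',
          ← R.symm.measurePreserving.lintegral_comp hF'm,
          ← lintegral_horiz_vert (fun y => F' (R.symm y)) (hF'm.comp R.symm.continuous.measurable)]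
        refine lintegral_congr fun q => ?_
        simp only [hadd]
        exact lintegral_add_right_eq_self (fun s => F' (R.symm !₂[q 0, q 1, s])) (h q)

end Graph

/-! ### Averages of translates -/

theorem eLpNorm_two_sq {α F : Type*} [NormedAddCommGroup F] [MeasurableSpace α] {μ : Measure α}
    (f : α → F) :
    eLpNorm f 2 μ ^ 2 = ∫⁻ x, ‖f x‖ₑ ^ 2 ∂μ := by
  have := eLpNorm_nnreal_pow_eq_lintegral (μ := μ) (f := f) (p := 2) two_ne_zero
  simpa using this

theorem eLpNorm_two_le_iff {α F : Type*} [NormedAddCommGroup F] [MeasurableSpace α]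
    {μ : Measure α} (f : α → F) (B : ℝ≥0∞) : eLpNorm f 2 μ ≤ B ↔ ∫⁻ x, ‖f x‖ₑ ^ 2 ∂μ ≤ B ^ 2 := by
  rw [← eLpNorm_two_sq, ENNReal.pow_le_pow_left_iff two_ne_zero]

/-- Translation is continuous in `L²`. -/
theorem tendsto_translate_sub {F : Type*} [NormedAddCommGroup F] {W : E3 → F} (hW : MemLp W 2) :
    Tendsto (fun a => ∫⁻ y, ‖W (y - a) - W y‖ₑ ^ 2) (𝓝 0) (𝓝 0) := by
  have : Fact ((2 : ℝ≥0∞) ≠ ⊤) := ⟨by norm_num⟩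
  have h1 : Continuous fun a : E3 => (DomAddAct.mk (-a) +ᵥ hW.toLp W : Lp F 2 (volume : Measure E3)) :=
    (DomAddAct.continuous_mk.comp continuous_neg).vadd continuous_const
  have h2 : Continuous fun a : E3 =>
      ‖(DomAddAct.mk (-a) +ᵥ hW.toLp W : Lp F 2 (volume : Measure E3)) - hW.toLp W‖ₑ ^ 2 :=
    (ENNReal.continuous_pow 2).comp (h1.sub continuous_const).enorm
  have h3 := h2.tendsto 0
  have e (a : E3) : ‖(DomAddAct.mk (-a) +ᵥ hW.toLp W : Lp F 2 (volume : Measure E3)) - hW.toLp W‖ₑ ^ 2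
      = ∫⁻ y, ‖W (y - a) - W y‖ₑ ^ 2 := by
    rw [DomAddAct.mk_vadd_toLp, ← MemLp.toLp_sub, Lp.enorm_toLp, eLpNorm_two_sq]
    refine lintegral_congr fun y => ?_
    simp [sub_eq_neg_add]
  simp only [e] at h3
  simpa using h3

section Averages

variable {F : Type*} [NormedAddCommGroup F] [NormedSpace ℝ F]

/-- The average of the translates `W (· - a)` against the normalized bump `b`; this is the
convolution of `W` with `b`. The bump need not be centred at the origin. -/
noncomputable def avg {c : E3} (b : ContDiffBump c) (W : E3 → F) (y : E3) : F :=
  ∫ a, b.normed volume a • W (y - a)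

theorem lintegral_normed {c : E3} (b : ContDiffBump c) :
    ∫⁻ a, ENNReal.ofReal (b.normed volume a) = 1 := by
  rw [← ofReal_integral_eq_lintegral_ofReal b.integrable_normed
    (Eventually.of_forall fun x => b.nonneg_normed x), b.integral_normed, ENNReal.ofReal_one]

theorem measurable_ofReal_normed {c : E3} (b : ContDiffBump c) :
    Measurable fun a => ENNReal.ofReal (b.normed volume a) :=
  b.continuous_normed.measurable.ennreal_ofReal

/-- Jensen's inequality for the square. -/
theorem enorm_integral_normed_smul_sq_le {c : E3} (b : ContDiffBump c) {V : E3 → F}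
    (hV : AEStronglyMeasurable V volume) :
    ‖∫ a, b.normed volume a • V a‖ₑ ^ 2
      ≤ ∫⁻ a, ENNReal.ofReal (b.normed volume a) * ‖V a‖ₑ ^ 2 := by
  set P : Measure E3 := volume.withDensity fun a => ENNReal.ofReal (b.normed volume a) with hP
  have hPp : IsProbabilityMeasure P := ⟨by
    rw [hP, withDensity_apply _ MeasurableSet.univ, setLIntegral_univ, lintegral_normed]⟩
  have hVP : AEStronglyMeasurable V P := hV.mono_ac (withDensity_absolutelyContinuous _ _)
  have hlt : ∀ᵐ a : E3, ENNReal.ofReal (b.normed volume a) < ⊤ :=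
    Eventually.of_forall fun _ => ENNReal.ofReal_lt_top
  have h1 : ∫ a, b.normed volume a • V a = ∫ a, V a ∂P := by
    rw [hP, integral_withDensity_eq_integral_toReal_smul (measurable_ofReal_normed b) hlt]
    simp only [ENNReal.toReal_ofReal (b.nonneg_normed _)]
  have h2 : ∫⁻ a, ENNReal.ofReal (b.normed volume a) * ‖V a‖ₑ ^ 2 = ∫⁻ a, ‖V a‖ₑ ^ 2 ∂P := by
    rw [hP, lintegral_withDensity_eq_lintegral_mul₀' (measurable_ofReal_normed b).aemeasurable]
    · rfl
    · exact hVP.enorm.pow_const 2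
  rw [h1, h2, ← eLpNorm_two_sq]
  gcongr
  refine (enorm_integral_le_lintegral_enorm V).trans ?_
  rw [← eLpNorm_one_eq_lintegral_enorm]
  exact eLpNorm_le_eLpNorm_of_exponent_le (by norm_num) hVP

theorem integrable_normed_smul_sub {c : E3} (b : ContDiffBump c) {W : E3 → F}
    (hW : LocallyIntegrable W) (y : E3) :
    Integrable fun a => b.normed volume a • W (y - a) := by
  have h := b.hasCompactSupport_normed (μ := (volume : Measure E3)).convolutionExists_left
    (ContinuousLinearMap.lsmul ℝ ℝ) b.continuous_normed hW y
  exact h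

/-- The `L²` distance on `S` between `W` and its average is at most the largest `L²` distance on `S`
between `W` and the translates that enter the average. -/
theorem avg_sub_sq_le [MeasurableSpace F] [BorelSpace F] [CompleteSpace F] {c : E3}
    (b : ContDiffBump c) {W : E3 → F} (hWm : StronglyMeasurable W) (hW : LocallyIntegrable W)
    (S : Set E3) (B : ℝ≥0∞)
    (hB : ∀ a ∈ Metric.ball c b.rOut, ∫⁻ y in S, ‖W (y - a) - W y‖ₑ ^ 2 ≤ B) :
    ∫⁻ y in S, ‖avg b W y - W y‖ₑ ^ 2 ≤ B := by
  have h1 (y : E3) : avg b W y - W y = ∫ a, b.normed volume a • (W (y - a) - W y) := by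
    simp only [smul_sub]
    rw [integral_sub (integrable_normed_smul_sub b hW y) (b.integrable_normed.smul_const _),
      integral_smul_const, b.integral_normed, one_smul]
    rfl
  have hm : StronglyMeasurable fun z : E3 × E3 => W (z.1 - z.2) - W z.1 :=
    (hWm.comp_measurable (measurable_fst.sub measurable_snd)).sub (hWm.comp_measurable measurable_fst)
  calc ∫⁻ y in S, ‖avg b W y - W y‖ₑ ^ 2
      ≤ ∫⁻ y in S, ∫⁻ a, ENNReal.ofReal (b.normed volume a) * ‖W (y - a) - W y‖ₑ ^ 2 := by
        refine lintegral_mono fun y => ?_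
        rw [h1]
        exact enorm_integral_normed_smul_sq_le b
          (hm.comp_measurable measurable_prodMk_left).aestronglyMeasurable
    _ = ∫⁻ a, ∫⁻ y in S, ENNReal.ofReal (b.normed volume a) * ‖W (y - a) - W y‖ₑ ^ 2 := by
        refine lintegral_lintegral_swap (Measurable.aemeasurable ?_)
        exact ((measurable_ofReal_normed b).comp measurable_snd).mul (hm.enorm.pow_const 2)
    _ = ∫⁻ a, ENNReal.ofReal (b.normed volume a) * ∫⁻ y in S, ‖W (y - a) - W y‖ₑ ^ 2 := by
        refine lintegral_congr fun a => lintegral_const_mul _ ?_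
        exact (hm.comp_measurable (measurable_id.prodMk measurable_const)).enorm.pow_const 2
    _ ≤ ∫⁻ a, ENNReal.ofReal (b.normed volume a) * B := by
        refine lintegral_mono fun a => ?_
        by_cases ha : a ∈ Metric.ball c b.rOut
        · gcongr; exact hB a ha
        · rw [← b.support_normed_eq (μ := (volume : Measure E3)), Function.notMem_support] at ha
          simp [ha]
    _ = B := by
        rw [lintegral_mul_const _ (measurable_ofReal_normed b), lintegral_normed, one_mul]

/-- Averages over kernels concentrated near the origin converge in `L²`; the kernels need neither be
centred nor symmetric. -/
theorem exists_avg_sub_sq_le [MeasurableSpace F] [BorelSpace F] [CompleteSpace F] {W : E3 → F}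
    (hWm : StronglyMeasurable W) (hW : MemLp W 2) {ε : ℝ≥0∞} (hε : 0 < ε) :
    ∃ δ : ℝ, 0 < δ ∧ ∀ (c : E3) (b : ContDiffBump c), ‖c‖ + b.rOut < δ →
      ∫⁻ y, ‖avg b W y - W y‖ₑ ^ 2 ≤ ε := by
  have h := ENNReal.tendsto_nhds_zero.1 (tendsto_translate_sub hW) ε hε
  obtain ⟨δ, hδ, H⟩ := Metric.eventually_nhds_iff.1 h
  refine ⟨δ, hδ, fun c b hb => ?_⟩
  have := avg_sub_sq_le b hWm (hW.locallyIntegrable (by norm_num)) Set.univ ε fun a ha => ?_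
  · simpa using this
  · rw [setLIntegral_univ]
    apply H
    rw [Metric.mem_ball, dist_eq_norm] at ha
    rw [dist_zero_right]
    calc ‖a‖ = ‖(a - c) + c‖ := by rw [sub_add_cancel]
      _ ≤ ‖a - c‖ + ‖c‖ := norm_add_le _ _
      _ < δ := by linarith

theorem avg_eq_integral {c : E3} (b : ContDiffBump c) (W : E3 → F) (y : E3) :
    avg b W y = ∫ z, b.normed volume (y - z) • W z := by
  have := integral_sub_left_eq_self (fun a => b.normed volume a • W (y - a)) volume y
  rw [avg, ← this]
  simp

theorem contDiff_avg {c : E3} (b : ContDiffBump c) {W : E3 → ℝ} (hW : LocallyIntegrable W) :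
    ContDiff ℝ ∞ (avg b W) := by
  have h := b.hasCompactSupport_normed (μ := (volume : Measure E3)).contDiff_convolution_left
    (n := (⊤ : ℕ∞)) (ContinuousLinearMap.lsmul ℝ ℝ) b.contDiff_normed hW
  exact h

theorem fderiv_avg_apply {c : E3} (b : ContDiffBump c) {W : E3 → ℝ} (hW : LocallyIntegrable W)
    (y e : E3) :
    fderiv ℝ (avg b W) y e = ∫ z, fderiv ℝ (b.normed volume) (y - z) e * W z := by
  have hs := b.hasCompactSupport_normed (μ := (volume : Measure E3))
  have hd : ContDiff ℝ 1 (b.normed (volume : Measure E3)) := b.contDiff_normed (n := 1)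
  have h := hs.hasFDerivAt_convolution_right (ContinuousLinearMap.mul ℝ ℝ) hW hd y
  have e1 : convolution W (b.normed volume) (ContinuousLinearMap.mul ℝ ℝ) volume = avg b W := by
    ext y
    rw [avg_eq_integral, convolution_def]
    refine integral_congr_ae (Eventually.of_forall fun z => ?_)
    simp [mul_comm]
  rw [e1] at h
  rw [h.fderiv, convolution_def, ContinuousLinearMap.integral_apply]
  · refine integral_congr_ae (Eventually.of_forall fun z => ?_)
    simp [ContinuousLinearMap.precompR_apply, mul_comm]
  · exact (hs.fderiv (𝕜 := ℝ)).convolutionExists_right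
      (ContinuousLinearMap.precompR E3 (ContinuousLinearMap.mul ℝ ℝ)) hW
      (hd.continuous_fderiv (by simp)) y

end Averages

/-! ### Density of smooth functions in `H¹(Ω)` -/

section Density

variable {Ω : Set E3}

theorem inner_gradient_eq (φ : E3 → ℝ) (y e : E3) : ⟪gradient φ y, e⟫ = fderiv ℝ φ y e := by
  simp [gradient]

theorem continuous_gradient {φ : E3 → ℝ} (h : ContDiff ℝ ∞ φ) : Continuous (gradient φ) :=
  (InnerProductSpace.toDual ℝ E3).symm.continuous.comp (h.continuous_fderiv (by simp))

theorem gradient_hasCompactSupport {φ : E3 → ℝ} (h : HasCompactSupport φ) :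
    HasCompactSupport (gradient φ) :=
  (h.fderiv (𝕜 := ℝ)).comp_left (map_zero _)

/-- Where the kernel, reflected at `y`, meets the support of the cutoff `χ` only inside `Ω`, the
average of `χ u`, extended by zero, has the average of the weak gradient of `χ u` as gradient. -/
theorem gradient_avg_indicator (hΩ : IsOpen Ω) {u : E3 → ℝ} {G : E3 → E3}
    (hu2 : MemLp u 2 (vol Ω)) (hG2 : MemLp G 2 (vol Ω))
    (huG : IsWeakGradient Ω u G) {χ : E3 → ℝ} (hχ : ContDiff ℝ ∞ χ) (hχc : HasCompactSupport χ)
    {c : E3} (b : ContDiffBump c) (y : E3)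
    (hy : ∀ z ∈ tsupport χ, y - z ∈ Metric.closedBall c b.rOut → z ∈ Ω) :
    gradient (avg b (Ω.indicator fun z => χ z * u z)) y
      = avg b (Ω.indicator fun z => χ z • G z + u z • gradient χ z) y := by
  set k := b.normed (volume : Measure E3) with hk
  have hkd : ContDiff ℝ ∞ k := b.contDiff_normed (n := (⊤ : ℕ∞))
  have hΩm := hΩ.measurableSet
  have hb : MemLp χ ⊤ (vol Ω) := hχ.continuous.memLp_top_of_hasCompactSupport hχc _
  have hb' : MemLp (gradient χ) ⊤ (vol Ω) :=
    (continuous_gradient hχ).memLp_top_of_hasCompactSupport (gradient_hasCompactSupport hχc) _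
  have hV2 : MemLp (fun z => χ z • G z + u z • gradient χ z) 2 (vol Ω) :=
    (hG2.smul hb).add (hb'.smul hu2)
  have hχu : MemLp (fun z => χ z * u z) 2 (vol Ω) := hu2.mul hb
  have hw : LocallyIntegrable (Ω.indicator fun z => χ z * u z) :=
    ((memLp_indicator_iff_restrict hΩm).2 hχu).locallyIntegrable (by norm_num)
  have hW : LocallyIntegrable (Ω.indicator fun z => χ z • G z + u z • gradient χ z) :=
    ((memLp_indicator_iff_restrict hΩm).2 hV2).locallyIntegrable (by norm_num)
  refine ext_inner_right ℝ fun e => ?_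
  rw [inner_gradient_eq, fderiv_avg_apply b hw, ← hk]
  -- the test function for the weak gradient: the cutoff times the reflected kernel
  set ψ : E3 → ℝ := fun z => χ z * k (y - z) with hψ
  have hψd : ContDiff ℝ ∞ ψ := hχ.mul (hkd.comp (contDiff_const.sub contDiff_id))
  have hψc : HasCompactSupport ψ := hχc.mul_right
  have hψs : tsupport ψ ⊆ Ω := by
    intro z hz
    have h1 : z ∈ tsupport χ := tsupport_mul_subset_left hz
    have h2 : z ∈ tsupport (fun z => k (y - z)) := tsupport_mul_subset_right hz
    have h3 : z ∈ (fun z => y - z) ⁻¹' tsupport k :=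
      tsupport_comp_subset_preimage k (continuous_const.sub continuous_id) h2
    rw [Set.mem_preimage, hk, b.tsupport_normed_eq] at h3
    exact hy z h1 h3
  have hψf (z : E3) : fderiv ℝ ψ z e
      = χ z * -(fderiv ℝ k (y - z) e) + k (y - z) * fderiv ℝ χ z e := by
    have h1 : HasFDerivAt χ (fderiv ℝ χ z) z := (hχ.differentiable (by simp) z).hasFDerivAt
    have h2 : HasFDerivAt k (fderiv ℝ k (y - z)) (y - z) :=
      (hkd.differentiable (by simp) _).hasFDerivAt
    have h3 : HasFDerivAt (fun z => k (y - z)) (-(fderiv ℝ k (y - z))) z := by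
      refine (h2.comp z ((hasFDerivAt_id z).const_sub y)).congr_fderiv ?_
      ext v; simp
    have := (h1.mul h3).fderiv
    rw [hψ]
    change fderiv ℝ (χ * fun z => k (y - z)) z e = _
    rw [this]; simp
  have hweak := huG ψ hψd hψc hψs e
  have hkc := b.hasCompactSupport_normed (μ := (volume : Measure E3))
  have hkyc : HasCompactSupport fun z => k (y - z) :=
    hkc.comp_homeomorph (Homeomorph.subLeft y)
  have hky : Continuous fun z => k (y - z) := hkd.continuous.comp (continuous_const.sub continuous_id)
  have i1 : Integrable (fun z => u z * (k (y - z) * fderiv ℝ χ z e)) (vol Ω) :=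
    integrable_mul_of_test hu2 (hky.mul (continuous_fderiv_test hχ e)) hkyc.mul_right
  have i2 : Integrable (fun z => ⟪G z, e⟫ * ψ z) (vol Ω) :=
    integrable_mul_of_test (memLp_inner_const hG2 e) hψd.continuous hψc
  have i3 : Integrable (fun z => u z * fderiv ℝ ψ z e) (vol Ω) :=
    integrable_mul_of_test hu2 (continuous_fderiv_test hψd e) (hasCompactSupport_fderiv_test hψc e)
  have e1 : ∫ z, fderiv ℝ k (y - z) e * Ω.indicator (fun z => χ z * u z) z
      = ∫ z in Ω, (u z * (k (y - z) * fderiv ℝ χ z e) - u z * fderiv ℝ ψ z e) := by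
    rw [← integral_indicator hΩm]
    refine integral_congr_ae (Eventually.of_forall fun z => ?_)
    by_cases hz : z ∈ Ω
    · simp only [Set.indicator_of_mem hz, hψf]; ring
    · simp [Set.indicator_of_notMem hz]
  rw [e1, integral_sub i1 i3, hweak, sub_neg_eq_add, ← integral_add i1 i2, avg_eq_integral,
    real_inner_comm]
  have i4 : Integrable (fun z => k (y - z) •
      Ω.indicator (fun z => χ z • G z + u z • gradient χ z) z) := by
    have := integrable_normed_smul_sub b hW y
    have h5 := (integrable_comp_sub_left (fun a => b.normed volume a •
      Ω.indicator (fun z => χ z • G z + u z • gradient χ z) (y - a)) y).2 this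
    simpa using h5
  rw [← integral_inner i4, ← integral_indicator hΩm]
  refine integral_congr_ae (Eventually.of_forall fun z => ?_)
  by_cases hz : z ∈ Ω
  · simp only [Set.indicator_of_mem hz, hψ]
    rw [real_inner_smul_right, inner_add_right, real_inner_smul_right, real_inner_smul_right,
      real_inner_comm (G z) e, real_inner_comm (gradient χ z) e, inner_gradient_eq]
    ring
  · simp [Set.indicator_of_notMem hz]

/-- Approximation of a localized function: the kernel is shifted into the cone along which one stays
inside `Ω`. -/
theorem exists_smooth_approx_cutoff (hΩ : IsOpen Ω) {u : E3 → ℝ} {G : E3 → E3}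
    (hum : StronglyMeasurable u) (hGm : StronglyMeasurable G)
    (hu2 : MemLp u 2 (vol Ω)) (hG2 : MemLp G 2 (vol Ω)) (huG : IsWeakGradient Ω u G)
    {x e : E3} {c ρ : ℝ} (hc : 0 < c)
    (hcone : ∀ y ∈ Ω ∩ Metric.ball x ρ, ∀ t ∈ Set.Ioo 0 ρ,
        ∀ v ∈ Metric.closedBall (t • e) (c * t), y + v ∈ Ω)
    {χ : E3 → ℝ} (hχ : ContDiff ℝ ∞ χ) (hχc : HasCompactSupport χ)
    (hχs : tsupport χ ⊆ Metric.ball x ρ) {ε : ℝ≥0∞} (hε : 0 < ε) :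
    ∃ φ : E3 → ℝ, ContDiff ℝ ∞ φ ∧ eLpNorm (fun z => φ z - χ z * u z) 2 (vol Ω) ≤ ε ∧
      eLpNorm (fun z => gradient φ z - (χ z • G z + u z • gradient χ z)) 2 (vol Ω) ≤ ε := by
  have hΩm := hΩ.measurableSet
  have hb : MemLp χ ⊤ (vol Ω) := hχ.continuous.memLp_top_of_hasCompactSupport hχc _
  have hb' : MemLp (gradient χ) ⊤ (vol Ω) :=
    (continuous_gradient hχ).memLp_top_of_hasCompactSupport (gradient_hasCompactSupport hχc) _
  have hw2 : MemLp (Ω.indicator fun z => χ z * u z) 2 :=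
    (memLp_indicator_iff_restrict hΩm).2 (hu2.mul hb)
  have hW2 : MemLp (Ω.indicator fun z => χ z • G z + u z • gradient χ z) 2 :=
    (memLp_indicator_iff_restrict hΩm).2 ((hG2.smul hb).add (hb'.smul hu2))
  have hwm : StronglyMeasurable (Ω.indicator fun z => χ z * u z) :=
    (hχ.continuous.stronglyMeasurable.mul hum).indicator hΩm
  have hWm : StronglyMeasurable (Ω.indicator fun z => χ z • G z + u z • gradient χ z) :=
    ((hχ.continuous.stronglyMeasurable.smul hGm).add
      (hum.smul (continuous_gradient hχ).stronglyMeasurable)).indicator hΩm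
  obtain ⟨δ₁, hδ₁, H₁⟩ := exists_avg_sub_sq_le hwm hw2 (ε := ε ^ 2) (by positivity)
  obtain ⟨δ₂, hδ₂, H₂⟩ := exists_avg_sub_sq_le hWm hW2 (ε := ε ^ 2) (by positivity)
  -- the points closer than `η` to the support of the cutoff still lie in the ball
  obtain ⟨η, hη, Hη⟩ := hχc.isCompact.exists_cthickening_subset_open Metric.isOpen_ball hχs
  by_cases hρ : 0 < ρ
  swap
  · have hz : χ = 0 := by
      rw [← tsupport_eq_empty_iff]
      refine Set.subset_empty_iff.1 (hχs.trans ?_)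
      rw [Metric.ball_eq_empty.2 (not_lt.1 hρ)]
    subst hz
    refine ⟨0, contDiff_const, ?_, ?_⟩
    · simp
    · have : gradient (0 : E3 → ℝ) = 0 := by ext1 z; simp [gradient]
      simp [this]
  -- a point and its translates by the kernel of scale `t` are at distance at most `t * m`
  set m := ‖e‖ + c with hm
  have hm0 : 0 < m := by positivity
  set t := min (min (ρ / 2) (η / m)) (min (δ₁ / (2 * m)) (δ₂ / (2 * m))) with ht
  have ht0 : 0 < t := by positivity
  have htρ : t < ρ := lt_of_le_of_lt ((min_le_left _ _).trans (min_le_left _ _)) (by linarith)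
  have htη : t * m ≤ η := (le_div_iff₀ hm0).1 ((min_le_left _ _).trans (min_le_right _ _))
  have htδ₁ : t * (2 * m) ≤ δ₁ :=
    (le_div_iff₀ (by positivity)).1 ((min_le_right _ _).trans (min_le_left _ _))
  have htδ₂ : t * (2 * m) ≤ δ₂ :=
    (le_div_iff₀ (by positivity)).1 ((min_le_right _ _).trans (min_le_right _ _))
  have htm : 0 < t * m := by positivity
  have hct : 0 < c * t := by positivity
  let b : ContDiffBump (-(t • e)) := ⟨c * t / 2, c * t, by positivity, by linarith⟩
  have hbO : b.rOut = c * t := rfl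
  have hsz : ‖-(t • e)‖ + b.rOut = t * m := by
    rw [norm_neg, norm_smul, Real.norm_of_nonneg ht0.le, hbO, hm]; ring
  have hloc := hw2.locallyIntegrable (by norm_num)
  refine ⟨avg b (Ω.indicator fun z => χ z * u z), contDiff_avg b hloc, ?_, ?_⟩
  · rw [eLpNorm_two_le_iff]
    refine le_trans ?_ (H₁ _ b (by rw [hsz]; linarith))
    refine le_trans (le_of_eq ?_) (setLIntegral_le_lintegral Ω _)
    refine setLIntegral_congr_fun hΩm fun z hz => ?_
    rw [Set.indicator_of_mem hz]
  · rw [eLpNorm_two_le_iff]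
    refine le_trans ?_ (H₂ _ b (by rw [hsz]; linarith))
    refine le_trans (le_of_eq ?_) (setLIntegral_le_lintegral Ω _)
    refine setLIntegral_congr_fun hΩm fun y hy => ?_
    rw [Set.indicator_of_mem hy]
    beta_reduce
    rw [gradient_avg_indicator hΩ hu2 hG2 huG hχ hχc b y]
    intro z hz hyz
    have h1 : z - y ∈ Metric.closedBall (t • e) (c * t) := by
      rw [Metric.mem_closedBall, dist_eq_norm] at hyz ⊢
      rwa [show z - y - t • e = -(y - z - -(t • e)) by abel, norm_neg]
    have h2 : y ∈ Metric.ball x ρ := by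
      apply Hη
      refine Metric.mem_cthickening_of_dist_le y z η _ hz ?_
      rw [dist_eq_norm]
      refine le_trans ?_ htη
      rw [← hsz]
      rw [Metric.mem_closedBall, dist_eq_norm] at hyz
      calc ‖y - z‖ = ‖-(t • e) + (y - z - -(t • e))‖ := by congr 1; abel
        _ ≤ _ := (norm_add_le _ _).trans (by gcongr)
    have := hcone y ⟨hy, h2⟩ t ⟨ht0, htρ⟩ _ h1
    rwa [add_sub_cancel] at this

/-- Functions smooth on all of space are dense in `H¹(Ω)`. -/
theorem exists_smooth_approx (hΩ : IsOpen Ω) (hΩb : Bornology.IsBounded Ω)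
    (hΩs : HasSmoothBoundary Ω) (u : H1 Ω) {ε : ℝ≥0∞} (hε : 0 < ε) :
    ∃ φ : E3 → ℝ, ContDiff ℝ ∞ φ ∧ eLpNorm (fun z => φ z - fn u z) 2 (vol Ω) ≤ ε ∧
      eLpNorm (fun z => gradient φ z - grad u z) 2 (vol Ω) ≤ ε := by
  have hΩm := hΩ.measurableSet
  have hK : IsCompact (closure Ω) := hΩb.isCompact_closure
  choose! e c ρ hc hρ hcone using exists_interior_cone hΩ hΩs
  obtain ⟨s, hs, hcov⟩ := hK.elim_nhds_subcover (fun x => Metric.ball x (ρ x))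
    fun x hx => Metric.ball_mem_nhds x (hρ x hx)
  obtain ⟨f, hf⟩ := SmoothPartitionOfUnity.exists_isSubordinate (modelWithCornersSelf ℝ E3)
    isClosed_closure (fun i : s => Metric.ball (i : E3) (ρ i)) (fun _ => Metric.isOpen_ball)
    (by simpa only [Set.iUnion_subtype] using hcov)
  have hfd (i : s) : ContDiff ℝ ∞ (f i) := (f i).contMDiff.contDiff
  have hfc (i : s) : HasCompactSupport (f i) :=
    (isCompact_closedBall (i : E3) (ρ i)).of_isClosed_subset (isClosed_tsupport _)
      ((hf i).trans Metric.ball_subset_closedBall)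
  have hsum : ∀ z ∈ closure Ω, ∑ i, f i z = 1 := by
    intro z hz
    rw [← finsum_eq_sum_of_fintype]
    exact f.sum_eq_one hz
  have hgsum : ∀ z ∈ Ω, ∑ i, gradient (f i) z = 0 := by
    intro z hz
    refine ext_inner_right ℝ fun v => ?_
    rw [sum_inner, inner_zero_left]
    simp only [inner_gradient_eq]
    have h1 : (fun z => ∑ i, f i z) =ᶠ[𝓝 z] fun _ => 1 := by
      filter_upwards [hΩ.mem_nhds hz] with y hy using hsum y (subset_closure hy)
    have h2 := h1.fderiv_eq (𝕜 := ℝ)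
    rw [fderiv_fun_sum fun i _ => (hfd i).differentiable (by simp) z] at h2
    simpa using congrArg (fun T => T v) h2
  set ε' : ℝ≥0∞ := ε / (Fintype.card s + 1) with hε'
  have hε'0 : 0 < ε' := ENNReal.div_pos hε.ne' (by finiteness)
  have hsumε : ∑ _i : s, ε' ≤ ε := by
    rw [Finset.sum_const, Finset.card_univ, nsmul_eq_mul]
    refine le_trans ?_ (ENNReal.mul_div_le (a := (Fintype.card s + 1 : ℝ≥0∞)))
    gcongr
    exact le_self_add
  have key (i : s) := exists_smooth_approx_cutoff hΩ (Lp.stronglyMeasurable (fn u))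
    (Lp.stronglyMeasurable (grad u)) (Lp.memLp (fn u)) (Lp.memLp (grad u)) u.2
    (hc i (hs i i.2)) (hcone i (hs i i.2)) (hfd i) (hfc i) (hf i) hε'0
  choose φ hφ h1 h2 using key
  have hcu (i : s) : AEStronglyMeasurable (fun z => φ i z - f i z * fn u z) (vol Ω) :=
    (hφ i).continuous.aestronglyMeasurable.sub
      ((hfd i).continuous.aestronglyMeasurable.mul (Lp.aestronglyMeasurable _))
  have hcg (i : s) : AEStronglyMeasurable (fun z => gradient (φ i) z -
      (f i z • grad u z + fn u z • gradient (f i) z)) (vol Ω) :=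
    (continuous_gradient (hφ i)).aestronglyMeasurable.sub
      (((hfd i).continuous.aestronglyMeasurable.smul (Lp.aestronglyMeasurable _)).add
        ((Lp.aestronglyMeasurable (fn u)).smul (continuous_gradient (hfd i)).aestronglyMeasurable))
  refine ⟨fun z => ∑ i, φ i z, ContDiff.sum fun i _ => hφ i, ?_, ?_⟩
  · have e1 : eLpNorm (fun z => (∑ i, φ i z) - fn u z) 2 (vol Ω)
        = eLpNorm (∑ i, fun z => φ i z - f i z * fn u z) 2 (vol Ω) := by
      refine eLpNorm_congr_ae ?_
      filter_upwards [ae_restrict_mem hΩm] with z hz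
      rw [Finset.sum_apply, Finset.sum_sub_distrib, ← Finset.sum_mul, hsum z (subset_closure hz),
        one_mul]
    rw [e1]
    exact (eLpNorm_sum_le (fun i _ => hcu i) (by norm_num)).trans
      ((Finset.sum_le_sum fun i _ => h1 i).trans hsumε)
  · have e2 : eLpNorm (fun z => gradient (fun z => ∑ i, φ i z) z - grad u z) 2 (vol Ω)
        = eLpNorm (∑ i, fun z => gradient (φ i) z -
            (f i z • grad u z + fn u z • gradient (f i) z)) 2 (vol Ω) := by
      refine eLpNorm_congr_ae ?_
      filter_upwards [ae_restrict_mem hΩm] with z hz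
      have e3 : gradient (fun z => ∑ i, φ i z) z = ∑ i, gradient (φ i) z := by
        refine ext_inner_right ℝ fun v => ?_
        rw [inner_gradient_eq, sum_inner,
          fderiv_fun_sum fun i _ => (hφ i).differentiable (by simp) z]
        simp
      rw [Finset.sum_apply, Finset.sum_sub_distrib, Finset.sum_add_distrib, ← Finset.sum_smul,
        hsum z (subset_closure hz), one_smul, ← Finset.smul_sum, hgsum z hz, smul_zero, add_zero, e3]
    rw [e2]
    exact (eLpNorm_sum_le (fun i _ => hcg i) (by norm_num)).trans
      ((Finset.sum_le_sum fun i _ => h2 i).trans hsumε)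

end Density

/-! ### Rellich's theorem and the trace inequality for smooth functions -/

section Increments

theorem enorm_gradient (φ : E3 → ℝ) (y : E3) : ‖gradient φ y‖ₑ = ‖fderiv ℝ φ y‖ₑ := by
  rw [← ofReal_norm, ← ofReal_norm, gradient, LinearIsometryEquiv.norm_map]

theorem two_mul_ofReal (x : ℝ) : 2 * ENNReal.ofReal x = ENNReal.ofReal (2 * x) := by
  rw [ENNReal.ofReal_mul zero_le_two, ENNReal.ofReal_ofNat]

/-- The Cauchy–Schwarz inequality against the constant function `1`. -/
theorem lintegral_sq_le {α : Type*} [MeasurableSpace α] (μ : Measure α) {f : α → ℝ≥0∞}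
    (hf : AEMeasurable f μ) : (∫⁻ x, f x ∂μ) ^ 2 ≤ μ Set.univ * ∫⁻ x, f x ^ 2 ∂μ := by
  have h := ENNReal.lintegral_mul_le_Lp_mul_Lq μ Real.HolderConjugate.two_two
    (aemeasurable_const (b := (1 : ℝ≥0∞))) hf
  simp only [Pi.mul_apply, one_mul, ENNReal.one_rpow, lintegral_const] at h
  calc (∫⁻ x, f x ∂μ) ^ 2 ≤ (μ Set.univ ^ (1 / 2 : ℝ) * (∫⁻ x, f x ^ (2 : ℝ) ∂μ) ^ (1 / 2 : ℝ)) ^ 2 := by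
        gcongr
    _ = μ Set.univ * ∫⁻ x, f x ^ 2 ∂μ := by
        rw [mul_pow, ← ENNReal.rpow_natCast, ← ENNReal.rpow_mul, ← ENNReal.rpow_natCast,
          ← ENNReal.rpow_mul]
        norm_num

/-- The increment of a smooth function along a segment, by the fundamental theorem of calculus and
the Cauchy–Schwarz inequality. -/
theorem enorm_sub_sq_le {φ : E3 → ℝ} (hφ : ContDiff ℝ ∞ φ) (y e : E3) {t : ℝ} (ht : 0 ≤ t) :
    ‖φ (y + t • e) - φ y‖ₑ ^ 2
      ≤ ENNReal.ofReal t * ‖e‖ₑ ^ 2 * ∫⁻ σ in Set.Ioo 0 t, ‖gradient φ (y + σ • e)‖ₑ ^ 2 := by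
  have hg : Continuous fun σ : ℝ => fderiv ℝ φ (y + σ • e) e :=
    (continuous_fderiv_test hφ e).comp (by fun_prop)
  have hderiv (σ : ℝ) : HasDerivAt (fun σ : ℝ => φ (y + σ • e)) (fderiv ℝ φ (y + σ • e) e) σ := by
    have h1 : HasDerivAt (fun σ : ℝ => y + σ • e) e σ := by
      simpa using ((hasDerivAt_id σ).smul_const e).const_add y
    exact ((hφ.differentiable (by simp) _).hasFDerivAt).comp_hasDerivAt σ h1
  have h1 := intervalIntegral.integral_eq_sub_of_hasDerivAt (a := 0) (b := t)
    (fun σ _ => hderiv σ) (hg.intervalIntegrable _ _)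
  rw [zero_smul, add_zero, intervalIntegral.integral_of_le ht, integral_Ioc_eq_integral_Ioo] at h1
  rw [← h1]
  have hgm : Measurable fun σ : ℝ => ‖gradient φ (y + σ • e)‖ₑ :=
    ((continuous_gradient hφ).comp (by fun_prop : Continuous fun σ : ℝ => y + σ • e)).enorm.measurable
  calc ‖∫ σ in Set.Ioo 0 t, fderiv ℝ φ (y + σ • e) e‖ₑ ^ 2
      ≤ (∫⁻ σ in Set.Ioo 0 t, ‖fderiv ℝ φ (y + σ • e) e‖ₑ) ^ 2 := by
        gcongr; exact enorm_integral_le_lintegral_enorm _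
    _ ≤ (∫⁻ σ in Set.Ioo 0 t, ‖e‖ₑ * ‖gradient φ (y + σ • e)‖ₑ) ^ 2 := by
        gcongr with σ
        rw [enorm_gradient, mul_comm]
        exact ContinuousLinearMap.le_opENorm _ _
    _ ≤ (volume.restrict (Set.Ioo 0 t)) Set.univ *
          ∫⁻ σ in Set.Ioo 0 t, (‖e‖ₑ * ‖gradient φ (y + σ • e)‖ₑ) ^ 2 :=
        lintegral_sq_le _ (hgm.const_mul _).aemeasurable
    _ = _ := by
        simp only [mul_pow]
        rw [lintegral_const_mul _ (hgm.pow_const 2), Measure.restrict_apply_univ, Real.volume_Ioo,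
          sub_zero, mul_assoc]

theorem enorm_sq_le_two_mul {F : Type*} [NormedAddCommGroup F] (p q : F) :
    ‖p‖ₑ ^ 2 ≤ 2 * ‖q‖ₑ ^ 2 + 2 * ‖q - p‖ₑ ^ 2 := by
  have h1 : ‖p‖ ≤ ‖q‖ + ‖q - p‖ := by
    calc ‖p‖ = ‖q - (q - p)‖ := by rw [sub_sub_cancel]
      _ ≤ _ := norm_sub_le _ _
  have h2 : ‖p‖ ^ 2 ≤ 2 * ‖q‖ ^ 2 + 2 * ‖q - p‖ ^ 2 := by
    nlinarith [norm_nonneg p, sq_nonneg (‖q‖ - ‖q - p‖)]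
  have h3 := ENNReal.ofReal_le_ofReal h2
  rw [ENNReal.ofReal_add (by positivity) (by positivity), ENNReal.ofReal_mul (by norm_num),
    ENNReal.ofReal_mul (by norm_num), ENNReal.ofReal_pow (by positivity),
    ENNReal.ofReal_pow (by positivity), ENNReal.ofReal_pow (by positivity)] at h3
  simpa [ofReal_norm] using h3

end Increments

section Rellich

variable {Ω : Set E3}

/-- Near a point of the closure, the averages over kernels shifted into the cone approximate
uniformly all functions with bounded gradient. -/
theorem exists_avg_bound (hΩ : IsOpen Ω) (hΩs : HasSmoothBoundary Ω) (x : E3)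
    (hx : x ∈ closure Ω) :
    ∃ ρ : ℝ, 0 < ρ ∧ ∀ ε : ℝ, 0 < ε → ∃ (c : E3) (b : ContDiffBump c),
      ∀ φ : E3 → ℝ, ContDiff ℝ ∞ φ → MemLp φ 2 (vol Ω) →
        ∫⁻ y in Ω ∩ Metric.ball x ρ, ‖φ y‖ₑ ^ 2
          ≤ 2 * (∫⁻ y in Ω, ‖avg b (Ω.indicator φ) y‖ₑ ^ 2)
            + ENNReal.ofReal ε * ∫⁻ y in Ω, ‖gradient φ y‖ₑ ^ 2 := by
  obtain ⟨e, c, ρ, hc, hρ, hcone⟩ := exists_interior_cone hΩ hΩs x hx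
  refine ⟨ρ, hρ, fun ε hε => ?_⟩
  have hΩm := hΩ.measurableSet
  set m := ‖e‖ + c with hm
  have hm0 : 0 < m := by positivity
  set t := min (ρ / 2) (min (1 / m) (ε / (2 * m))) with ht
  have ht0 : 0 < t := by positivity
  have htρ : t < ρ := lt_of_le_of_lt (min_le_left _ _) (by linarith)
  have ht1 : t * m ≤ 1 := (le_div_iff₀ hm0).1 ((min_le_right _ _).trans (min_le_left _ _))
  have htε : t * (2 * m) ≤ ε :=
    (le_div_iff₀ (by positivity)).1 ((min_le_right _ _).trans (min_le_right _ _))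
  have htm : 0 < t * m := by positivity
  have hct : 0 < c * t := by positivity
  let b : ContDiffBump (-(t • e)) := ⟨c * t / 2, c * t, by positivity, by linarith⟩
  refine ⟨_, b, fun φ hφ hφ2 => ?_⟩
  set W := Ω.indicator φ with hW
  have hWm : StronglyMeasurable W := hφ.continuous.stronglyMeasurable.indicator hΩm
  have hWl : LocallyIntegrable W :=
    ((memLp_indicator_iff_restrict hΩm).2 hφ2).locallyIntegrable (by norm_num)
  set S := Ω ∩ Metric.ball x ρ with hS
  have hSm : MeasurableSet S := hΩm.inter Metric.isOpen_ball.measurableSet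
  have hgm : Measurable fun y => ‖gradient φ y‖ₑ ^ 2 :=
    (continuous_gradient hφ).enorm.measurable.pow_const 2
  have key : ∫⁻ y in S, ‖avg b W y - W y‖ₑ ^ 2
      ≤ ENNReal.ofReal (t * m) * ∫⁻ y in Ω, ‖gradient φ y‖ₑ ^ 2 := by
    refine avg_sub_sq_le b hWm hWl S _ fun a ha => ?_
    have ha' : ‖-a - t • e‖ < c * t := by
      rw [Metric.mem_ball, dist_eq_norm] at ha
      rwa [show -a - t • e = -(a - -(t • e)) by abel, norm_neg]
    have han : ‖-a‖ ≤ t * m := by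
      calc ‖-a‖ = ‖(-a - t • e) + t • e‖ := by rw [sub_add_cancel]
        _ ≤ ‖-a - t • e‖ + ‖t • e‖ := norm_add_le _ _
        _ ≤ c * t + t * ‖e‖ := by
          rw [norm_smul, Real.norm_of_nonneg ht0.le]; gcongr
        _ = t * m := by rw [hm]; ring
    have hin : ∀ y ∈ S, ∀ σ ∈ Set.Ioc (0 : ℝ) 1, y + σ • (-a) ∈ Ω := by
      rintro y hy σ ⟨hσ0, hσ1⟩
      refine hcone y hy (σ * t) ⟨by positivity, by nlinarith⟩ _ ?_
      rw [Metric.mem_closedBall, dist_eq_norm, mul_smul, ← smul_sub, norm_smul,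
        Real.norm_of_nonneg hσ0.le]
      nlinarith
    have ham : ‖-a‖ₑ ^ 2 ≤ ENNReal.ofReal (t * m) := by
      rw [← ofReal_norm, ← ENNReal.ofReal_pow (norm_nonneg _)]
      apply ENNReal.ofReal_le_ofReal
      nlinarith [norm_nonneg (-a)]
    calc ∫⁻ y in S, ‖W (y - a) - W y‖ₑ ^ 2
        ≤ ∫⁻ y in S, ENNReal.ofReal (t * m) *
            ∫⁻ σ in Set.Ioo (0 : ℝ) 1, ‖gradient φ (y + σ • (-a))‖ₑ ^ 2 := by
          refine setLIntegral_mono_ae' hSm (Eventually.of_forall fun y hy => ?_)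
          have h1 := hin y hy 1 ⟨one_pos, le_rfl⟩
          rw [one_smul] at h1
          have h2 := enorm_sub_sq_le hφ y (-a) zero_le_one
          rw [one_smul, ENNReal.ofReal_one, one_mul] at h2
          rw [sub_eq_add_neg y a, hW, Set.indicator_of_mem h1, Set.indicator_of_mem hy.1]
          exact h2.trans (by gcongr)
      _ = ENNReal.ofReal (t * m) *
            ∫⁻ σ in Set.Ioo (0 : ℝ) 1, ∫⁻ y in S, ‖gradient φ (y + σ • (-a))‖ₑ ^ 2 := by
          have hj : Measurable fun z : E3 × ℝ => ‖gradient φ (z.1 + z.2 • (-a))‖ₑ ^ 2 :=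
            hgm.comp (by fun_prop : Measurable fun z : E3 × ℝ => z.1 + z.2 • (-a))
          rw [lintegral_const_mul _ hj.lintegral_prod_right', lintegral_lintegral_swap]
          exact hj.aemeasurable
      _ ≤ ENNReal.ofReal (t * m) *
            ∫⁻ _σ in Set.Ioo (0 : ℝ) 1, ∫⁻ y in Ω, ‖gradient φ y‖ₑ ^ 2 := by
          gcongr ENNReal.ofReal (t * m) * ?_
          refine setLIntegral_mono_ae' measurableSet_Ioo (Eventually.of_forall fun σ hσ => ?_)
          rw [← lintegral_indicator hSm, ← lintegral_indicator hΩm,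
            ← lintegral_add_right_eq_self (Ω.indicator fun y => ‖gradient φ y‖ₑ ^ 2) (σ • (-a))]
          refine lintegral_mono fun y => ?_
          by_cases hy : y ∈ S
          · rw [Set.indicator_of_mem hy, Set.indicator_of_mem (hin y hy σ ⟨hσ.1, hσ.2.le⟩)]
          · rw [Set.indicator_of_notMem hy]; exact zero_le
      _ = _ := by simp
  calc ∫⁻ y in S, ‖φ y‖ₑ ^ 2
      ≤ ∫⁻ y in S, (2 * ‖avg b W y‖ₑ ^ 2 + 2 * ‖avg b W y - W y‖ₑ ^ 2) := by
        refine setLIntegral_mono_ae' hSm (Eventually.of_forall fun y hy => ?_)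
        have : W y = φ y := Set.indicator_of_mem hy.1 _
        rw [← this]
        exact enorm_sq_le_two_mul _ _
    _ = 2 * (∫⁻ y in S, ‖avg b W y‖ₑ ^ 2) + 2 * ∫⁻ y in S, ‖avg b W y - W y‖ₑ ^ 2 := by
        have hA : Measurable fun y => ‖avg b W y‖ₑ ^ 2 :=
          (contDiff_avg b hWl).continuous.enorm.measurable.pow_const 2
        have hB : Measurable fun y => ‖avg b W y - W y‖ₑ ^ 2 :=
          ((contDiff_avg b hWl).continuous.measurable.sub hWm.measurable).enorm.pow_const 2
        rw [lintegral_add_left (hA.const_mul _), lintegral_const_mul _ hA,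
          lintegral_const_mul _ hB]
    _ ≤ 2 * (∫⁻ y in Ω, ‖avg b W y‖ₑ ^ 2)
          + 2 * (ENNReal.ofReal (t * m) * ∫⁻ y in Ω, ‖gradient φ y‖ₑ ^ 2) := by
        gcongr
        exact Set.inter_subset_left
    _ ≤ _ := by
        gcongr (2 * ∫⁻ y in Ω, ‖avg b W y‖ₑ ^ 2) + ?_
        rw [← mul_assoc, two_mul_ofReal]
        gcongr
        linarith

/-- Averaging against a fixed kernel turns weak into strong convergence: for fixed `y` the average is
the pairing with a test function, and the averages are uniformly bounded. -/
theorem tendsto_avg_indicator (hΩ : IsOpen Ω) (hΩb : Bornology.IsBounded Ω) {c : E3}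
    (b : ContDiffBump c) {φ : ℕ → E3 → ℝ} (hφ : ∀ n, MemLp (φ n) 2 (vol Ω)) {M : NNReal}
    (hM : ∀ n, ∫⁻ y in Ω, ‖φ n y‖ₑ ^ 2 ≤ M)
    (hw : ∀ ψ : E3 → ℝ, Continuous ψ → HasCompactSupport ψ →
      Tendsto (fun n => ∫ y in Ω, φ n y * ψ y) atTop (𝓝 0)) :
    Tendsto (fun n => ∫⁻ y in Ω, ‖avg b (Ω.indicator (φ n)) y‖ₑ ^ 2) atTop (𝓝 0) := by
  have hΩm := hΩ.measurableSet
  have hfin : volume Ω ≠ ⊤ := hΩb.measure_lt_top.ne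
  have hl (n : ℕ) : MemLp (Ω.indicator (φ n)) 2 := (memLp_indicator_iff_restrict hΩm).2 (hφ n)
  obtain ⟨A, hA⟩ := (b.hasCompactSupport_normed (μ := (volume : Measure E3))).exists_bound_of_continuous
    b.continuous_normed
  have h0 : ∫⁻ _y in Ω, (0 : ℝ≥0∞) = 0 := by simp
  rw [← h0]
  refine tendsto_lintegral_of_dominated_convergence (fun _ => ENNReal.ofReal A * M) (fun n => ?_)
    (fun n => Eventually.of_forall fun y => ?_) ?_ (Eventually.of_forall fun y => ?_)
  · exact (contDiff_avg b ((hl n).locallyIntegrable (by norm_num))).continuous.enorm.measurable.pow_const 2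
  · refine (enorm_integral_normed_smul_sq_le b ((hl n).aestronglyMeasurable.comp_quasiMeasurePreserving
      (quasiMeasurePreserving_sub_left volume y))).trans ?_
    calc ∫⁻ a, ENNReal.ofReal (b.normed volume a) * ‖(Ω.indicator (φ n) ∘ fun h => y - h) a‖ₑ ^ 2
        ≤ ∫⁻ a, ENNReal.ofReal A * ‖Ω.indicator (φ n) (y - a)‖ₑ ^ 2 := by
          refine lintegral_mono fun a => ?_
          rw [Function.comp_apply]
          gcongr
          exact (le_abs_self _).trans (hA a)
      _ = ENNReal.ofReal A * ∫⁻ z, ‖Ω.indicator (φ n) z‖ₑ ^ 2 := by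
          rw [lintegral_const_mul' _ _ ENNReal.ofReal_ne_top,
            lintegral_sub_left_eq_self (fun z => ‖Ω.indicator (φ n) z‖ₑ ^ 2) y]
      _ ≤ ENNReal.ofReal A * M := by
          gcongr
          refine le_trans (le_of_eq ?_) (hM n)
          rw [← lintegral_indicator hΩm]
          refine lintegral_congr fun z => ?_
          by_cases hz : z ∈ Ω
          · simp [Set.indicator_of_mem hz]
          · simp [Set.indicator_of_notMem hz]
  · rw [lintegral_const, Measure.restrict_apply_univ]
    finiteness
  · have hk : Continuous fun z => b.normed (volume : Measure E3) (y - z) :=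
      b.continuous_normed.comp (by fun_prop)
    have hkc : HasCompactSupport fun z => b.normed (volume : Measure E3) (y - z) :=
      (b.hasCompactSupport_normed (μ := (volume : Measure E3))).comp_homeomorph (Homeomorph.subLeft y)
    have h1 := hw _ hk hkc
    have h2 (n : ℕ) : ∫ z in Ω, φ n z * b.normed volume (y - z) = avg b (Ω.indicator (φ n)) y := by
      rw [avg_eq_integral, ← integral_indicator hΩm]
      refine integral_congr_ae (Eventually.of_forall fun z => ?_)
      by_cases hz : z ∈ Ω
      · simp [Set.indicator_of_mem hz, mul_comm]
      · simp [Set.indicator_of_notMem hz]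
    simp only [h2] at h1
    have h3 := ((ENNReal.continuous_pow 2).comp continuous_enorm).tendsto (0 : ℝ) |>.comp h1
    simpa [Function.comp_def] using h3

/-- Rellich's theorem for smooth functions: a sequence bounded in `H¹(Ω)` and weakly null in `L²(Ω)`
tends to zero in `L²(Ω)`. -/
theorem tendsto_lintegral_sq_of_weakly_null (hΩ : IsOpen Ω) (hΩb : Bornology.IsBounded Ω)
    (hΩs : HasSmoothBoundary Ω) {φ : ℕ → E3 → ℝ} (hφ : ∀ n, ContDiff ℝ ∞ (φ n)) {M : NNReal}
    (hM : ∀ n, ∫⁻ y in Ω, ‖φ n y‖ₑ ^ 2 ≤ M) (hM' : ∀ n, ∫⁻ y in Ω, ‖gradient (φ n) y‖ₑ ^ 2 ≤ M)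
    (hw : ∀ ψ : E3 → ℝ, Continuous ψ → HasCompactSupport ψ →
      Tendsto (fun n => ∫ y in Ω, φ n y * ψ y) atTop (𝓝 0)) :
    Tendsto (fun n => ∫⁻ y in Ω, ‖φ n y‖ₑ ^ 2) atTop (𝓝 0) := by
  have hφ2 (n : ℕ) : MemLp (φ n) 2 (vol Ω) := by
    refine ⟨(hφ n).continuous.aestronglyMeasurable, ?_⟩
    have : eLpNorm (φ n) 2 (vol Ω) ^ 2 < ⊤ := by
      rw [eLpNorm_two_sq]; exact (hM n).trans_lt ENNReal.coe_lt_top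
    rwa [ENNReal.pow_lt_top_iff, or_iff_left two_ne_zero] at this
  have hloc : ∀ x ∈ closure Ω, ∃ ρ : ℝ, 0 < ρ ∧
      Tendsto (fun n => ∫⁻ y in Ω ∩ Metric.ball x ρ, ‖φ n y‖ₑ ^ 2) atTop (𝓝 0) := by
    intro x hx
    obtain ⟨ρ, hρ, H⟩ := exists_avg_bound hΩ hΩs x hx
    refine ⟨ρ, hρ, ENNReal.tendsto_nhds_zero.2 fun η hη => ?_⟩
    obtain ⟨η', hη'0, hη'⟩ := ENNReal.lt_iff_exists_nnreal_btwn.1 hη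
    have hη'0 : 0 < η' := by exact_mod_cast hη'0
    set ε : ℝ := η' / (2 * (M + 1)) with hε
    have hε0 : 0 < ε := by positivity
    have hεM : ε * M ≤ η' / 2 := by
      rw [hε, div_mul_eq_mul_div, div_le_div_iff₀ (by positivity) (by norm_num)]
      nlinarith [M.2, η'.2]
    obtain ⟨c, b, hb⟩ := H ε hε0
    have h1 := ENNReal.tendsto_nhds_zero.1 (tendsto_avg_indicator hΩ hΩb b hφ2 hM hw)
      (ENNReal.ofReal (η' / 4)) (by positivity)
    filter_upwards [h1] with n hn
    refine (hb (φ n) (hφ n) (hφ2 n)).trans (le_trans ?_ hη'.le)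
    calc _ ≤ 2 * ENNReal.ofReal (η' / 4) + ENNReal.ofReal ε * M := by gcongr; exact hM' n
      _ = ENNReal.ofReal (2 * (η' / 4) + ε * M) := by
          rw [ENNReal.ofReal_add (by positivity) (by positivity), ENNReal.ofReal_mul (by norm_num),
            ENNReal.ofReal_mul hε0.le]
          simp
      _ ≤ ENNReal.ofReal η' := ENNReal.ofReal_le_ofReal (by linarith)
      _ = η' := ENNReal.ofReal_coe_nnreal
  choose! ρ hρ hlim using hloc
  obtain ⟨s, hs, hcov⟩ := hΩb.isCompact_closure.elim_nhds_subcover (fun x => Metric.ball x (ρ x))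
    fun x hx => Metric.ball_mem_nhds x (hρ x hx)
  have hsum : Tendsto (fun n => ∑ i : s, ∫⁻ y in Ω ∩ Metric.ball (i : E3) (ρ i), ‖φ n y‖ₑ ^ 2)
      atTop (𝓝 0) := by
    simpa using tendsto_finsetSum Finset.univ fun (i : s) _ => hlim i (hs i i.2)
  refine tendsto_of_tendsto_of_tendsto_of_le_of_le tendsto_const_nhds hsum (fun n => zero_le)
    fun n => ?_
  have hsub : Ω ⊆ ⋃ i : s, Ω ∩ Metric.ball (i : E3) (ρ i) := by
    intro z hz
    have := hcov (subset_closure hz)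
    simp only [Set.mem_iUnion] at this ⊢
    obtain ⟨i, hi, hzi⟩ := this
    exact ⟨⟨i, hi⟩, hz, hzi⟩
  calc ∫⁻ y in Ω, ‖φ n y‖ₑ ^ 2
      ≤ ∫⁻ y in ⋃ i : s, Ω ∩ Metric.ball (i : E3) (ρ i), ‖φ n y‖ₑ ^ 2 := lintegral_mono_set hsub
    _ ≤ ∑' i : s, ∫⁻ y in Ω ∩ Metric.ball (i : E3) (ρ i), ‖φ n y‖ₑ ^ 2 := lintegral_iUnion_le _ _
    _ = _ := tsum_fintype _

end Rellich

section SmoothTrace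

variable {Ω : Set E3}

/-- The trace inequality for smooth functions, with an arbitrarily small constant in front of the
gradient. -/
theorem exists_smooth_trace_bound (hΩ : IsOpen Ω) (hΩb : Bornology.IsBounded Ω)
    (hΩs : HasSmoothBoundary Ω) {ε : ℝ} (hε : 0 < ε) :
    ∃ C : NNReal, ∀ φ : E3 → ℝ, ContDiff ℝ ∞ φ →
      ∫⁻ y, ‖φ y‖ₑ ^ 2 ∂(surface Ω)
        ≤ C * (∫⁻ y in Ω, ‖φ y‖ₑ ^ 2) + ENNReal.ofReal ε * ∫⁻ y in Ω, ‖gradient φ y‖ₑ ^ 2 := by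
  have hloc : ∀ x ∈ frontier Ω, ∃ ρ : ℝ, 0 < ρ ∧ ∀ ε : ℝ, 0 < ε → ∃ C : NNReal,
      ∀ φ : E3 → ℝ, ContDiff ℝ ∞ φ → ∫⁻ y in Metric.ball x ρ, ‖φ y‖ₑ ^ 2 ∂(surface Ω)
        ≤ C * (∫⁻ y in Ω, ‖φ y‖ₑ ^ 2) + ENNReal.ofReal ε * ∫⁻ y in Ω, ‖gradient φ y‖ₑ ^ 2 := by
    intro x hx
    obtain ⟨e, ρ, C, hρ, H⟩ := exists_slide_bound hΩ hΩs x hx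
    refine ⟨ρ, hρ, fun ε hε => ?_⟩
    -- sliding over a time `τ` costs `2 / τ` in front of `φ` and gains `τ` in front of its gradient
    set m : ℝ := 2 * C * ‖e‖ ^ 2 + 1 with hm
    have hm0 : 0 < m := by positivity
    set τ := min ρ (ε / m) with hτ
    have hτ0 : 0 < τ := by positivity
    have hτε : τ * m ≤ ε := (le_div_iff₀ hm0).1 (min_le_right _ _)
    refine ⟨2 * C / Real.toNNReal τ, fun φ hφ => ?_⟩
    have hφm : Measurable fun y => ‖φ y‖ₑ ^ 2 := hφ.continuous.enorm.measurable.pow_const 2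
    have hgm : Measurable fun y => ‖gradient φ y‖ₑ ^ 2 :=
      (continuous_gradient hφ).enorm.measurable.pow_const 2
    set c := ENNReal.ofReal τ with hc
    have hc0 : c ≠ 0 := (ENNReal.ofReal_pos.2 hτ0).ne'
    have hct : c ≠ ⊤ := ENNReal.ofReal_ne_top
    have hpt (y : E3) : c * ‖φ y‖ₑ ^ 2 ≤ 2 * (∫⁻ t in Set.Ioo 0 ρ, ‖φ (y + t • e)‖ₑ ^ 2)
        + 2 * c ^ 2 * ‖e‖ₑ ^ 2 * ∫⁻ t in Set.Ioo 0 ρ, ‖gradient φ (y + t • e)‖ₑ ^ 2 := by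
      have hvol : volume (Set.Ioo 0 τ) = c := by rw [Real.volume_Ioo, sub_zero]
      have hsub : Set.Ioo 0 τ ⊆ Set.Ioo 0 ρ := Set.Ioo_subset_Ioo_right (min_le_left _ _)
      have hφy : Measurable fun t : ℝ => ‖φ (y + t • e)‖ₑ ^ 2 :=
        hφm.comp (by fun_prop : Measurable fun t : ℝ => y + t • e)
      set I := ∫⁻ t in Set.Ioo 0 ρ, ‖gradient φ (y + t • e)‖ₑ ^ 2 with hI
      calc c * ‖φ y‖ₑ ^ 2 = ∫⁻ _t in Set.Ioo 0 τ, ‖φ y‖ₑ ^ 2 := by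
            rw [setLIntegral_const, hvol, mul_comm]
        _ ≤ ∫⁻ t in Set.Ioo 0 τ, (2 * ‖φ (y + t • e)‖ₑ ^ 2 + 2 * (c * ‖e‖ₑ ^ 2 * I)) := by
            refine setLIntegral_mono_ae' measurableSet_Ioo (Eventually.of_forall fun t ht => ?_)
            refine (enorm_sq_le_two_mul (φ y) (φ (y + t • e))).trans ?_
            gcongr
            refine (enorm_sub_sq_le hφ y e ht.1.le).trans ?_
            have : Set.Ioo 0 t ⊆ Set.Ioo 0 ρ := (Set.Ioo_subset_Ioo_right ht.2.le).trans hsub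
            gcongr
            · exact ENNReal.ofReal_le_ofReal ht.2.le
            · exact lintegral_mono_set this
        _ = 2 * (∫⁻ t in Set.Ioo 0 τ, ‖φ (y + t • e)‖ₑ ^ 2) + 2 * c ^ 2 * ‖e‖ₑ ^ 2 * I := by
            rw [lintegral_add_left (hφy.const_mul _), lintegral_const_mul _ hφy,
              setLIntegral_const, hvol]
            ring
        _ ≤ _ := by gcongr
    have hφi : Measurable fun y : E3 => ∫⁻ t in Set.Ioo 0 ρ, ‖φ (y + t • e)‖ₑ ^ 2 :=
      Measurable.lintegral_prod_right' (f := fun z : E3 × ℝ => ‖φ (z.1 + z.2 • e)‖ₑ ^ 2)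
        (hφm.comp (by fun_prop))
    have hgi : Measurable fun y : E3 => ∫⁻ t in Set.Ioo 0 ρ, ‖gradient φ (y + t • e)‖ₑ ^ 2 :=
      Measurable.lintegral_prod_right' (f := fun z : E3 × ℝ => ‖gradient φ (z.1 + z.2 • e)‖ₑ ^ 2)
        (hgm.comp (by fun_prop))
    have key : c * ∫⁻ y in Metric.ball x ρ, ‖φ y‖ₑ ^ 2 ∂(surface Ω)
        ≤ 2 * (C * ∫⁻ y in Ω, ‖φ y‖ₑ ^ 2)
          + 2 * c ^ 2 * ‖e‖ₑ ^ 2 * (C * ∫⁻ y in Ω, ‖gradient φ y‖ₑ ^ 2) := by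
      rw [← lintegral_const_mul _ hφm]
      refine (lintegral_mono fun y => hpt y).trans ?_
      rw [lintegral_add_left (hφi.const_mul _), lintegral_const_mul _ hφi,
        lintegral_const_mul _ hgi]
      gcongr
      · exact H _ hφm
      · exact H _ hgm
    have hC : ((2 * C / Real.toNNReal τ : NNReal) : ℝ≥0∞) = 2 * C * c⁻¹ := by
      rw [ENNReal.coe_div (Real.toNNReal_pos.2 hτ0).ne', div_eq_mul_inv]
      push_cast
      rfl
    have h2 : 2 * c * ‖e‖ₑ ^ 2 * C ≤ ENNReal.ofReal ε := by
      rw [← ofReal_norm, ← ENNReal.ofReal_pow (norm_nonneg _), hc,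
        ← ENNReal.ofReal_coe_nnreal, two_mul_ofReal, ← ENNReal.ofReal_mul (by positivity), ← ENNReal.ofReal_mul (by positivity)]
      apply ENNReal.ofReal_le_ofReal
      nlinarith
    calc ∫⁻ y in Metric.ball x ρ, ‖φ y‖ₑ ^ 2 ∂(surface Ω)
        = c⁻¹ * (c * ∫⁻ y in Metric.ball x ρ, ‖φ y‖ₑ ^ 2 ∂(surface Ω)) := by
          rw [← mul_assoc, ENNReal.inv_mul_cancel hc0 hct, one_mul]
      _ ≤ c⁻¹ * (2 * (C * ∫⁻ y in Ω, ‖φ y‖ₑ ^ 2)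
          + 2 * c ^ 2 * ‖e‖ₑ ^ 2 * (C * ∫⁻ y in Ω, ‖gradient φ y‖ₑ ^ 2)) := by gcongr
      _ = 2 * C * c⁻¹ * (∫⁻ y in Ω, ‖φ y‖ₑ ^ 2)
          + (c⁻¹ * c) * (2 * c * ‖e‖ₑ ^ 2 * C) * ∫⁻ y in Ω, ‖gradient φ y‖ₑ ^ 2 := by ring
      _ ≤ _ := by
          rw [ENNReal.inv_mul_cancel hc0 hct, one_mul, hC]
          gcongr
  have hK : IsCompact (frontier Ω) :=
    hΩb.isCompact_closure.of_isClosed_subset isClosed_frontier frontier_subset_closure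
  choose! ρ hρ H using hloc
  obtain ⟨s, hs, hcov⟩ := hK.elim_nhds_subcover (fun x => Metric.ball x (ρ x))
    fun x hx => Metric.ball_mem_nhds x (hρ x hx)
  choose C hC using fun i : s => H i (hs i i.2) (ε / (Fintype.card s + 1)) (by positivity)
  refine ⟨∑ i, C i, fun φ hφ => ?_⟩
  have hsub : frontier Ω ⊆ ⋃ i : s, Metric.ball (i : E3) (ρ i) := by
    simpa only [Set.iUnion_subtype] using hcov
  calc ∫⁻ y, ‖φ y‖ₑ ^ 2 ∂(surface Ω)
      = ∫⁻ y in frontier Ω, ‖φ y‖ₑ ^ 2 ∂(surface Ω) := by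
        rw [surface, Measure.restrict_restrict isClosed_frontier.measurableSet, Set.inter_self]
    _ ≤ ∫⁻ y in ⋃ i : s, Metric.ball (i : E3) (ρ i), ‖φ y‖ₑ ^ 2 ∂(surface Ω) :=
        lintegral_mono_set hsub
    _ ≤ ∑' i : s, ∫⁻ y in Metric.ball (i : E3) (ρ i), ‖φ y‖ₑ ^ 2 ∂(surface Ω) :=
        lintegral_iUnion_le _ _
    _ = ∑ i : s, ∫⁻ y in Metric.ball (i : E3) (ρ i), ‖φ y‖ₑ ^ 2 ∂(surface Ω) := tsum_fintype _
    _ ≤ ∑ i : s, (C i * (∫⁻ y in Ω, ‖φ y‖ₑ ^ 2) + ENNReal.ofReal (ε / (Fintype.card s + 1))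
          * ∫⁻ y in Ω, ‖gradient φ y‖ₑ ^ 2) := Finset.sum_le_sum fun i _ => hC i φ hφ
    _ ≤ _ := by
        rw [Finset.sum_add_distrib, ← Finset.sum_mul, ← Finset.sum_mul]
        push_cast
        gcongr
        rw [← ENNReal.ofReal_sum_of_nonneg (fun _ _ => by positivity), Finset.sum_const,
          Finset.card_univ, nsmul_eq_mul]
        apply ENNReal.ofReal_le_ofReal
        rw [mul_div_assoc', div_le_iff₀ (by positivity)]
        nlinarith

end SmoothTrace

/-! ### The trace operator -/

section H1

variable {Ω : Set E3}

theorem norm_sq_H1 (u : H1 Ω) : ‖u‖ ^ 2 = ‖fn u‖ ^ 2 + ‖grad u‖ ^ 2 :=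
  WithLp.prod_norm_sq_eq_of_L2 u.1

theorem norm_fn_le (u : H1 Ω) : ‖fn u‖ ≤ ‖u‖ := by
  refine le_of_sq_le_sq ?_ (norm_nonneg u)
  rw [norm_sq_H1]
  nlinarith [sq_nonneg ‖grad u‖]

theorem norm_grad_le (u : H1 Ω) : ‖grad u‖ ≤ ‖u‖ := by
  refine le_of_sq_le_sq ?_ (norm_nonneg u)
  rw [norm_sq_H1]
  nlinarith [sq_nonneg ‖fn u‖]

theorem fn_add (u v : H1 Ω) : fn (u + v) = fn u + fn v := rfl
theorem fn_smul (c : ℝ) (u : H1 Ω) : fn (c • u) = c • fn u := rfl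
theorem grad_add (u v : H1 Ω) : grad (u + v) = grad u + grad v := rfl
theorem grad_smul (c : ℝ) (u : H1 Ω) : grad (c • u) = c • grad u := rfl

end H1

section Trace

variable {Ω : Set E3}

theorem isFiniteMeasure_vol (hΩb : Bornology.IsBounded Ω) : IsFiniteMeasure (vol Ω) :=
  ⟨by rw [Measure.restrict_apply_univ]; exact hΩb.measure_lt_top⟩

theorem isFiniteMeasure_surface (hΩ : IsOpen Ω) (hΩb : Bornology.IsBounded Ω)
    (hΩs : HasSmoothBoundary Ω) : IsFiniteMeasure (surface Ω) := by
  obtain ⟨C, hC⟩ := exists_smooth_trace_bound hΩ hΩb hΩs one_pos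
  have h := hC (fun _ => 1) contDiff_const
  have hg : gradient (fun _ : E3 => (1 : ℝ)) = 0 := by ext1 z; simp [gradient]
  rw [hg] at h
  simp at h
  exact ⟨h.trans_lt (ENNReal.mul_lt_top ENNReal.coe_lt_top hΩb.measure_lt_top)⟩

theorem memLp_vol_of_continuous {F : Type*} [NormedAddCommGroup F] (hΩ : IsOpen Ω)
    (hΩb : Bornology.IsBounded Ω) {φ : E3 → F} (hφ : Continuous φ) : MemLp φ 2 (vol Ω) := by
  have := isFiniteMeasure_vol hΩb
  obtain ⟨C, hC⟩ := hΩb.isCompact_closure.exists_bound_of_continuousOn hφ.continuousOn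
  refine MemLp.of_bound hφ.aestronglyMeasurable C ?_
  filter_upwards [ae_restrict_mem hΩ.measurableSet] with x hx using hC x (subset_closure hx)

theorem memLp_surface_of_continuous (hΩ : IsOpen Ω) (hΩb : Bornology.IsBounded Ω)
    (hΩs : HasSmoothBoundary Ω) {φ : E3 → ℝ} (hφ : Continuous φ) : MemLp φ 2 (surface Ω) := by
  have := isFiniteMeasure_surface hΩ hΩb hΩs
  obtain ⟨C, hC⟩ := hΩb.isCompact_closure.exists_bound_of_continuousOn hφ.continuousOn
  refine MemLp.of_bound hφ.aestronglyMeasurable C ?_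
  filter_upwards [ae_restrict_mem isClosed_frontier.measurableSet] with x hx
    using hC x (frontier_subset_closure hx)

theorem norm_toLp_sq {α F : Type*} [NormedAddCommGroup F] [MeasurableSpace α] {μ : Measure α}
    {f : α → F} (hf : MemLp f 2 μ) : ENNReal.ofReal (‖hf.toLp f‖ ^ 2) = ∫⁻ x, ‖f x‖ₑ ^ 2 ∂μ := by
  rw [ENNReal.ofReal_pow (norm_nonneg _), ofReal_norm, Lp.enorm_toLp, eLpNorm_two_sq]

theorem exists_smooth_trace_norm_bound (hΩ : IsOpen Ω) (hΩb : Bornology.IsBounded Ω)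
    (hΩs : HasSmoothBoundary Ω) {ε : ℝ} (hε : 0 < ε) :
    ∃ C : ℝ, 0 ≤ C ∧ ∀ φ : E3 → ℝ, ∀ hφ : ContDiff ℝ ∞ φ,
      ‖(memLp_surface_of_continuous hΩ hΩb hΩs hφ.continuous).toLp φ‖ ^ 2
        ≤ C * ‖(memLp_vol_of_continuous hΩ hΩb hφ.continuous).toLp φ‖ ^ 2
          + ε * ‖(memLp_vol_of_continuous hΩ hΩb (continuous_gradient hφ)).toLp (gradient φ)‖ ^ 2 := by
  obtain ⟨C, hC⟩ := exists_smooth_trace_bound hΩ hΩb hΩs hε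
  refine ⟨C, C.2, fun φ hφ => ?_⟩
  have h := hC φ hφ
  rw [← norm_toLp_sq (memLp_surface_of_continuous hΩ hΩb hΩs hφ.continuous),
    ← norm_toLp_sq (memLp_vol_of_continuous hΩ hΩb hφ.continuous),
    ← norm_toLp_sq (memLp_vol_of_continuous hΩ hΩb (continuous_gradient hφ)),
    ← ENNReal.ofReal_coe_nnreal, ← ENNReal.ofReal_mul (NNReal.coe_nonneg C), ← ENNReal.ofReal_mul hε.le,
    ← ENNReal.ofReal_add (by positivity) (by positivity)] at h
  exact (ENNReal.ofReal_le_ofReal_iff (by positivity)).1 h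

/-- The definition of the trace as convergence in the spaces `Lp`: on a bounded smooth domain every
smooth function and its gradient are square integrable. -/
theorem isTrace_iff (hΩ : IsOpen Ω) (hΩb : Bornology.IsBounded Ω) (hΩs : HasSmoothBoundary Ω)
    (u : H1 Ω) (ψ : Lp ℝ 2 (surface Ω)) :
    IsTrace u ψ ↔ ∃ (φ : ℕ → E3 → ℝ) (hφ : ∀ n, ContDiff ℝ ∞ (φ n)),
      Tendsto (fun n => (memLp_vol_of_continuous hΩ hΩb (hφ n).continuous).toLp (φ n)) atTop
        (𝓝 (fn u)) ∧
      Tendsto (fun n => (memLp_vol_of_continuous hΩ hΩb (continuous_gradient (hφ n))).toLp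
        (gradient (φ n))) atTop (𝓝 (grad u)) ∧
      Tendsto (fun n => (memLp_surface_of_continuous hΩ hΩb hΩs (hφ n).continuous).toLp (φ n)) atTop
        (𝓝 ψ) := by
  unfold IsTrace
  have key {α F : Type} [NormedAddCommGroup F] [MeasurableSpace α] {μ : Measure α}
      (f : ℕ → α → F) (hf : ∀ n, MemLp (f n) 2 μ) (g : Lp F 2 μ) :
      Tendsto (fun n => (hf n).toLp (f n)) atTop (𝓝 g) ↔
        Tendsto (fun n => eLpNorm (fun x => f n x - g x) 2 μ) atTop (𝓝 0) := by
    have := Lp.tendsto_Lp_iff_tendsto_eLpNorm'' (fi := atTop) f hf g (Lp.memLp g)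
    rwa [Lp.toLp_coeFn] at this
  constructor
  · rintro ⟨φ, hφ, h1, h2, h3⟩
    exact ⟨φ, hφ, (key _ _ _).2 h1, (key _ _ _).2 h2, (key _ _ _).2 h3⟩
  · rintro ⟨φ, hφ, h1, h2, h3⟩
    exact ⟨φ, hφ, (key _ _ _).1 h1, (key _ _ _).1 h2, (key _ _ _).1 h3⟩

theorem gradient_add_smul {φ χ : E3 → ℝ} (hφ : ContDiff ℝ ∞ φ) (hχ : ContDiff ℝ ∞ χ) (c : ℝ) :
    gradient (fun x => φ x + c * χ x) = fun x => gradient φ x + c • gradient χ x := by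
  ext1 x
  have h1 := (hφ.differentiable (by simp) x).hasGradientAt.hasFDerivAt
  have h2 := (hχ.differentiable (by simp) x).hasGradientAt.hasFDerivAt
  refine ext_inner_right ℝ fun v => ?_
  have h3 : HasFDerivAt (fun x => φ x + c * χ x) _ x := h1.add (h2.const_mul c)
  rw [inner_gradient_eq, h3.fderiv]
  simp [inner_add_left, real_inner_smul_left]

theorem IsTrace.add_smul (hΩ : IsOpen Ω) (hΩb : Bornology.IsBounded Ω) (hΩs : HasSmoothBoundary Ω)
    {u v : H1 Ω} {ψ χ : Lp ℝ 2 (surface Ω)} (hu : IsTrace u ψ) (hv : IsTrace v χ) (c : ℝ) :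
    IsTrace (u + c • v) (ψ + c • χ) := by
  rw [isTrace_iff hΩ hΩb hΩs] at hu hv ⊢
  obtain ⟨φ, hφ, h1, h2, h3⟩ := hu
  obtain ⟨φ', hφ', h1', h2', h3'⟩ := hv
  refine ⟨fun n x => φ n x + c * φ' n x, fun n => (hφ n).add (contDiff_const.mul (hφ' n)), ?_, ?_, ?_⟩
  · exact h1.add (h1'.const_smul c)
  · have := h2.add (h2'.const_smul c)
    refine this.congr fun n => ?_
    rw [← MemLp.toLp_const_smul, ← MemLp.toLp_add]
    refine (MemLp.toLp_eq_toLp_iff _ _).2 (Eventually.of_forall fun x => ?_)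
    simp only [gradient_add_smul (hφ n) (hφ' n)]
    rfl
  · exact h3.add (h3'.const_smul c)

/-- The trace inequality passes from smooth functions to the limit. -/
theorem IsTrace.norm_sq_le (hΩ : IsOpen Ω) (hΩb : Bornology.IsBounded Ω) (hΩs : HasSmoothBoundary Ω)
    {ε : ℝ} (hε : 0 < ε) :
    ∃ C : ℝ, 0 ≤ C ∧ ∀ (u : H1 Ω) (ψ : Lp ℝ 2 (surface Ω)), IsTrace u ψ →
      ‖ψ‖ ^ 2 ≤ C * ‖fn u‖ ^ 2 + ε * ‖grad u‖ ^ 2 := by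
  obtain ⟨C, hC0, hC⟩ := exists_smooth_trace_norm_bound hΩ hΩb hΩs hε
  refine ⟨C, hC0, fun u ψ h => ?_⟩
  rw [isTrace_iff hΩ hΩb hΩs] at h
  obtain ⟨φ, hφ, h1, h2, h3⟩ := h
  exact le_of_tendsto_of_tendsto' (h3.norm.pow 2)
    (((h1.norm.pow 2).const_mul C).add ((h2.norm.pow 2).const_mul ε)) fun n => hC (φ n) (hφ n)

theorem IsTrace.unique (hΩ : IsOpen Ω) (hΩb : Bornology.IsBounded Ω) (hΩs : HasSmoothBoundary Ω)
    {u : H1 Ω} {ψ χ : Lp ℝ 2 (surface Ω)} (hu : IsTrace u ψ) (hv : IsTrace u χ) : ψ = χ := by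
  obtain ⟨C, -, hC⟩ := IsTrace.norm_sq_le hΩ hΩb hΩs one_pos
  have h := hC _ _ (IsTrace.add_smul hΩ hΩb hΩs hu hv (-1))
  have e1 : fn (u + (-1 : ℝ) • u) = 0 := by rw [fn_add, fn_smul]; simp
  have e2 : grad (u + (-1 : ℝ) • u) = 0 := by rw [grad_add, grad_smul]; simp
  rw [e1, e2, norm_zero, norm_zero] at h
  have h0 : ψ + (-1 : ℝ) • χ = 0 := by
    rw [← norm_eq_zero, ← sq_eq_zero_iff]
    exact le_antisymm (by simpa using h) (sq_nonneg _)
  rw [neg_one_smul, ← sub_eq_add_neg] at h0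
  exact sub_eq_zero.1 h0

theorem exists_smooth_seq (hΩ : IsOpen Ω) (hΩb : Bornology.IsBounded Ω) (hΩs : HasSmoothBoundary Ω)
    (u : H1 Ω) : ∃ (φ : ℕ → E3 → ℝ) (hφ : ∀ n, ContDiff ℝ ∞ (φ n)),
      Tendsto (fun n => (memLp_vol_of_continuous hΩ hΩb (hφ n).continuous).toLp (φ n)) atTop
        (𝓝 (fn u)) ∧
      Tendsto (fun n => (memLp_vol_of_continuous hΩ hΩb (continuous_gradient (hφ n))).toLp
        (gradient (φ n))) atTop (𝓝 (grad u)) := by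
  choose φ hφ h1 h2 using fun n : ℕ => exists_smooth_approx hΩ hΩb hΩs u
    (ε := ((n : ℝ≥0∞) + 1)⁻¹) (by simp)
  have hlim : Tendsto (fun n : ℕ => ((n : ℝ≥0∞) + 1)⁻¹) atTop (𝓝 0) := by
    have := ENNReal.tendsto_inv_nat_nhds_zero.comp (tendsto_add_atTop_nat 1)
    simpa [Function.comp_def] using this
  refine ⟨φ, hφ, ?_, ?_⟩
  · have := (Lp.tendsto_Lp_iff_tendsto_eLpNorm'' φ
      (fun n => memLp_vol_of_continuous hΩ hΩb (hφ n).continuous) (fn u) (Lp.memLp (fn u))).2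
      (tendsto_of_tendsto_of_tendsto_of_le_of_le tendsto_const_nhds hlim (fun n => zero_le) h1)
    rwa [Lp.toLp_coeFn] at this
  · have := (Lp.tendsto_Lp_iff_tendsto_eLpNorm'' (fun n => gradient (φ n))
      (fun n => memLp_vol_of_continuous hΩ hΩb (continuous_gradient (hφ n))) (grad u)
      (Lp.memLp (grad u))).2
      (tendsto_of_tendsto_of_tendsto_of_le_of_le tendsto_const_nhds hlim (fun n => zero_le) h2)
    rwa [Lp.toLp_coeFn] at this

/-- The restrictions to the boundary of approximating smooth functions form a Cauchy sequence in
`L²(Γ)` by the trace inequality. -/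
theorem exists_isTrace (hΩ : IsOpen Ω) (hΩb : Bornology.IsBounded Ω) (hΩs : HasSmoothBoundary Ω)
    (u : H1 Ω) : ∃ ψ, IsTrace u ψ := by
  obtain ⟨φ, hφ, h1, h2⟩ := exists_smooth_seq hΩ hΩb hΩs u
  obtain ⟨C, hC0, hC⟩ := exists_smooth_trace_norm_bound hΩ hΩb hΩs one_pos
  suffices h : CauchySeq fun n =>
      (memLp_surface_of_continuous hΩ hΩb hΩs (hφ n).continuous).toLp (φ n) by
    obtain ⟨ψ, hψ⟩ := cauchySeq_tendsto_of_complete h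
    exact ⟨ψ, (isTrace_iff hΩ hΩb hΩs u ψ).2 ⟨φ, hφ, h1, h2, hψ⟩⟩
  rw [Metric.cauchySeq_iff]
  intro ε hε
  set δ := ε / (C + 1) with hδ
  have hδ0 : 0 < δ := by positivity
  obtain ⟨N₁, hN₁⟩ := Metric.cauchySeq_iff.1 h1.cauchySeq (δ / 2) (by positivity)
  obtain ⟨N₂, hN₂⟩ := Metric.cauchySeq_iff.1 h2.cauchySeq (δ / 2) (by positivity)
  refine ⟨max N₁ N₂, fun m hm n hn => ?_⟩
  have d1 := hN₁ m (le_of_max_le_left hm) n (le_of_max_le_left hn)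
  have d2 := hN₂ m (le_of_max_le_right hm) n (le_of_max_le_right hn)
  rw [dist_eq_norm] at d1 d2 ⊢
  have hs : ContDiff ℝ ∞ fun x => φ m x + -1 * φ n x := (hφ m).add (contDiff_const.mul (hφ n))
  have hb := hC _ hs
  have e1 : (memLp_surface_of_continuous hΩ hΩb hΩs hs.continuous).toLp _
      = (memLp_surface_of_continuous hΩ hΩb hΩs (hφ m).continuous).toLp (φ m)
        - (memLp_surface_of_continuous hΩ hΩb hΩs (hφ n).continuous).toLp (φ n) := by
    rw [← MemLp.toLp_sub]
    refine (MemLp.toLp_eq_toLp_iff _ _).2 (Eventually.of_forall fun x => ?_)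
    simp [sub_eq_add_neg]
  have e2 : (memLp_vol_of_continuous hΩ hΩb hs.continuous).toLp _
      = (memLp_vol_of_continuous hΩ hΩb (hφ m).continuous).toLp (φ m)
        - (memLp_vol_of_continuous hΩ hΩb (hφ n).continuous).toLp (φ n) := by
    rw [← MemLp.toLp_sub]
    refine (MemLp.toLp_eq_toLp_iff _ _).2 (Eventually.of_forall fun x => ?_)
    simp [sub_eq_add_neg]
  have e3 : (memLp_vol_of_continuous hΩ hΩb (continuous_gradient hs)).toLp _
      = (memLp_vol_of_continuous hΩ hΩb (continuous_gradient (hφ m))).toLp (gradient (φ m))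
        - (memLp_vol_of_continuous hΩ hΩb (continuous_gradient (hφ n))).toLp (gradient (φ n)) := by
    rw [← MemLp.toLp_sub]
    refine (MemLp.toLp_eq_toLp_iff _ _).2 (Eventually.of_forall fun x => ?_)
    simpa [sub_eq_add_neg] using congrFun (gradient_add_smul (hφ m) (hφ n) (-1)) x
  rw [e1, e2, e3] at hb
  refine lt_of_pow_lt_pow_left₀ 2 hε.le (hb.trans_lt ?_)
  have q1 : ‖(memLp_vol_of_continuous hΩ hΩb (hφ m).continuous).toLp (φ m)
        - (memLp_vol_of_continuous hΩ hΩb (hφ n).continuous).toLp (φ n)‖ ^ 2 ≤ (δ / 2) ^ 2 := by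
    gcongr
  have q2 : ‖(memLp_vol_of_continuous hΩ hΩb (continuous_gradient (hφ m))).toLp (gradient (φ m))
        - (memLp_vol_of_continuous hΩ hΩb (continuous_gradient (hφ n))).toLp (gradient (φ n))‖ ^ 2
        ≤ (δ / 2) ^ 2 := by
    gcongr
  have q3 : ε = δ * (C + 1) := by rw [hδ]; field_simp
  rw [q3]
  nlinarith [mul_le_mul_of_nonneg_left q1 hC0, sq_nonneg (C * δ), mul_nonneg hC0 (sq_nonneg δ),
    pow_pos hδ0 2]

theorem isTrace_trace (hΩ : IsOpen Ω) (hΩb : Bornology.IsBounded Ω) (hΩs : HasSmoothBoundary Ω)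
    (u : H1 Ω) : IsTrace u (trace u) := by
  have h := exists_isTrace hΩ hΩb hΩs u
  rw [trace, dif_pos h]
  exact h.choose_spec

theorem exists_norm_trace_sq_le (hΩ : IsOpen Ω) (hΩb : Bornology.IsBounded Ω)
    (hΩs : HasSmoothBoundary Ω) {ε : ℝ} (hε : 0 < ε) :
    ∃ C : ℝ, 0 ≤ C ∧ ∀ u : H1 Ω, ‖trace u‖ ^ 2 ≤ C * ‖fn u‖ ^ 2 + ε * ‖grad u‖ ^ 2 := by
  obtain ⟨C, hC0, hC⟩ := IsTrace.norm_sq_le hΩ hΩb hΩs hε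
  exact ⟨C, hC0, fun u => hC u _ (isTrace_trace hΩ hΩb hΩs u)⟩

theorem trace_add_smul (hΩ : IsOpen Ω) (hΩb : Bornology.IsBounded Ω) (hΩs : HasSmoothBoundary Ω)
    (u v : H1 Ω) (c : ℝ) : trace (u + c • v) = trace u + c • trace v :=
  IsTrace.unique hΩ hΩb hΩs (isTrace_trace hΩ hΩb hΩs _)
    (IsTrace.add_smul hΩ hΩb hΩs (isTrace_trace hΩ hΩb hΩs u) (isTrace_trace hΩ hΩb hΩs v) c)

/-- On a bounded smooth domain the trace is a continuous linear map. -/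
theorem exists_traceL (hΩ : IsOpen Ω) (hΩb : Bornology.IsBounded Ω) (hΩs : HasSmoothBoundary Ω) :
    ∃ T : H1 Ω →L[ℝ] Lp ℝ 2 (surface Ω), ∀ u, T u = trace u := by
  obtain ⟨C, hC0, hC⟩ := exists_norm_trace_sq_le hΩ hΩb hΩs one_pos
  have h0 : trace (0 : H1 Ω) = 0 := by
    have := trace_add_smul hΩ hΩb hΩs (0 : H1 Ω) 0 1
    simpa using this
  refine ⟨LinearMap.mkContinuous
    { toFun := trace
      map_add' := fun u v => by simpa using trace_add_smul hΩ hΩb hΩs u v 1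
      map_smul' := fun c u => by simpa [h0] using trace_add_smul hΩ hΩb hΩs 0 u c }
    (C + 1) fun u => ?_, fun u => rfl⟩
  refine le_of_sq_le_sq ?_ (by positivity)
  have h1 := hC u
  have h2 := norm_sq_H1 u
  change ‖trace u‖ ^ 2 ≤ _
  rw [mul_pow, h2]
  nlinarith [sq_nonneg ‖fn u‖, sq_nonneg ‖grad u‖, mul_nonneg hC0 (sq_nonneg ‖fn u‖),
    mul_nonneg hC0 (sq_nonneg ‖grad u‖), mul_nonneg (mul_nonneg hC0 hC0) (sq_nonneg ‖fn u‖),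
    mul_nonneg (mul_nonneg hC0 hC0) (sq_nonneg ‖grad u‖)]

end Trace

/-! ### Weak convergence in `H¹(Ω)` and test functions in `H^s(Ω)` -/

section WeakCompactness

/-- A bounded sequence in a separable Hilbert space has a weakly convergent subsequence. -/
theorem exists_weak_limit {E : Type*} [NormedAddCommGroup E] [InnerProductSpace ℝ E]
    [CompleteSpace E] [TopologicalSpace.SeparableSpace E] (z : ℕ → E) {M : ℝ}
    (hz : ∀ n, ‖z n‖ ≤ M) :
    ∃ (w : E) (ns : ℕ → ℕ), StrictMono ns ∧
      ∀ T : E →L[ℝ] ℝ, Tendsto (fun n => T (z (ns n))) atTop (𝓝 (T w)) := by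
  have hc := WeakDual.isSeqCompact_closedBall ℝ E 0 M
  obtain ⟨ℓ, -, ns, hns, hlim⟩ := hc
    (x := fun n => StrongDual.toWeakDual (InnerProductSpace.toDual ℝ E (z n))) fun n => by
      rw [Set.mem_preimage, mem_closedBall_zero_iff]
      exact ((InnerProductSpace.toDual ℝ E).norm_map (z n)).le.trans (hz n)
  refine ⟨(InnerProductSpace.toDual ℝ E).symm (WeakDual.toStrongDual ℓ), ns, hns, fun T => ?_⟩
  have h1 := (WeakDual.eval_continuous ((InnerProductSpace.toDual ℝ E).symm T)).tendsto ℓ |>.comp hlim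
  have h2 (x : E) : T x = ⟪x, (InnerProductSpace.toDual ℝ E).symm T⟫ := by
    rw [real_inner_comm, InnerProductSpace.toDual_symm_apply]
  have h3 : T ((InnerProductSpace.toDual ℝ E).symm (WeakDual.toStrongDual ℓ))
      = ℓ ((InnerProductSpace.toDual ℝ E).symm T) := by
    rw [h2, InnerProductSpace.toDual_symm_apply]; rfl
  rw [h3]
  refine h1.congr fun n => ?_
  rw [h2]
  rfl

end WeakCompactness

section Hilbert

variable {Ω : Set E3}

theorem L2_inner_toLp {α F : Type*} [NormedAddCommGroup F] [InnerProductSpace ℝ F]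
    [MeasurableSpace α] {μ : Measure α} {f : α → F} (hf : MemLp f 2 μ) (g : Lp F 2 μ) :
    ⟪hf.toLp f, g⟫ = ∫ x, ⟪f x, g x⟫ ∂μ := by
  rw [L2.inner_def]
  refine integral_congr_ae ?_
  filter_upwards [hf.coeFn_toLp] with x hx
  rw [hx]

/-- For a fixed test function the weak gradient condition equates two continuous functionals. -/
theorem isClosed_H1 : IsClosed (H1 Ω : Set (WithLp 2 (Lp ℝ 2 (vol Ω) × Lp E3 2 (vol Ω)))) := by
  have key : (H1 Ω : Set (WithLp 2 (Lp ℝ 2 (vol Ω) × Lp E3 2 (vol Ω)))) =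
      ⋂ (φ : E3 → ℝ) (_ : ContDiff ℝ ∞ φ) (_ : HasCompactSupport φ) (_ : tsupport φ ⊆ Ω) (e : E3),
        {p | ∫ x in Ω, p.fst x * fderiv ℝ φ x e = - ∫ x in Ω, ⟪p.snd x, e⟫ * φ x} := by
    ext p
    simp only [Set.mem_iInter]
    rfl
  rw [key]
  refine isClosed_iInter fun φ => isClosed_iInter fun h1 => isClosed_iInter fun h2 =>
    isClosed_iInter fun _ => isClosed_iInter fun e => ?_
  have m1 : MemLp (fun x => fderiv ℝ φ x e) 2 (vol Ω) :=
    (continuous_fderiv_test h1 e).memLp_of_hasCompactSupport (hasCompactSupport_fderiv_test h2 e)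
  have m2 : MemLp (fun x => φ x • e) 2 (vol Ω) :=
    (h1.continuous.smul continuous_const).memLp_of_hasCompactSupport h2.smul_right
  have e1 (p : WithLp 2 (Lp ℝ 2 (vol Ω) × Lp E3 2 (vol Ω))) :
      ∫ x in Ω, p.fst x * fderiv ℝ φ x e = ⟪m1.toLp _, p.fst⟫ := by
    rw [L2_inner_toLp]; rfl
  have e2 (p : WithLp 2 (Lp ℝ 2 (vol Ω) × Lp E3 2 (vol Ω))) :
      ∫ x in Ω, ⟪p.snd x, e⟫ * φ x = ⟪m2.toLp _, p.snd⟫ := by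
    rw [L2_inner_toLp]
    refine integral_congr_ae (Eventually.of_forall fun x => ?_)
    simp only [real_inner_smul_left]
    rw [real_inner_comm, mul_comm]
  simp only [e1, e2]
  exact isClosed_eq (continuous_const.inner (WithLp.fstL 2 ℝ _ _).continuous)
    (continuous_const.inner (WithLp.sndL 2 ℝ _ _).continuous).neg

theorem completeSpace_H1 : CompleteSpace (H1 Ω) :=
  (isClosed_H1 (Ω := Ω)).completeSpace_coe

theorem separableSpace_H1 : TopologicalSpace.SeparableSpace (H1 Ω) := by
  have : Fact ((2 : ℝ≥0∞) ≠ ⊤) := ⟨by norm_num⟩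
  have h1 : SecondCountableTopology (Lp ℝ 2 (vol Ω)) := inferInstance
  have h2 : SecondCountableTopology (Lp E3 2 (vol Ω)) := inferInstance
  have h3 : SecondCountableTopology (WithLp 2 (Lp ℝ 2 (vol Ω) × Lp E3 2 (vol Ω))) :=
    (WithLp.homeomorphProd 2 (Lp ℝ 2 (vol Ω)) (Lp E3 2 (vol Ω))).secondCountableTopology
  have h4 : SecondCountableTopology (H1 Ω) :=
    TopologicalSpace.Subtype.secondCountableTopology _
  infer_instance

/-- `fn` as a continuous linear map. -/
noncomputable def fnL (Ω : Set E3) : H1 Ω →L[ℝ] Lp ℝ 2 (vol Ω) :=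
  (WithLp.fstL 2 ℝ (Lp ℝ 2 (vol Ω)) (Lp E3 2 (vol Ω))).comp (H1 Ω).subtypeL

/-- `grad` as a continuous linear map. -/
noncomputable def gradL (Ω : Set E3) : H1 Ω →L[ℝ] Lp E3 2 (vol Ω) :=
  (WithLp.sndL 2 ℝ (Lp ℝ 2 (vol Ω)) (Lp E3 2 (vol Ω))).comp (H1 Ω).subtypeL

theorem fnL_apply (u : H1 Ω) : fnL Ω u = fn u := rfl

/-- Rellich's theorem in `H¹(Ω)`. -/
theorem tendsto_norm_fn_of_weakly_null (hΩ : IsOpen Ω) (hΩb : Bornology.IsBounded Ω)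
    (hΩs : HasSmoothBoundary Ω) {z : ℕ → H1 Ω} (hz : ∀ n, ‖z n‖ ≤ 1)
    (hw : ∀ ψ : Lp ℝ 2 (vol Ω), Tendsto (fun n => ⟪ψ, fn (z n)⟫) atTop (𝓝 0)) :
    Tendsto (fun n => ‖fn (z n)‖) atTop (𝓝 0) := by
  choose φ hφ h1 h2 using fun n : ℕ => exists_smooth_approx hΩ hΩb hΩs (z n)
    (ε := ENNReal.ofReal (1 / ((n : ℝ) + 1))) (by positivity)
  have m1 (n : ℕ) := memLp_vol_of_continuous hΩ hΩb (hφ n).continuous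
  have m2 (n : ℕ) := memLp_vol_of_continuous hΩ hΩb (continuous_gradient (hφ n))
  have d1 (n : ℕ) : ‖(m1 n).toLp (φ n) - fn (z n)‖ ≤ 1 / ((n : ℝ) + 1) := by
    rw [← ENNReal.ofReal_le_ofReal_iff (by positivity), ofReal_norm]
    refine le_trans (le_of_eq ?_) (h1 n)
    rw [Lp.enorm_def]
    refine eLpNorm_congr_ae ?_
    filter_upwards [Lp.coeFn_sub ((m1 n).toLp (φ n)) (fn (z n)), (m1 n).coeFn_toLp] with x e1 e2
    rw [e1, Pi.sub_apply, e2]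
  have d2 (n : ℕ) : ‖(m2 n).toLp (gradient (φ n)) - grad (z n)‖ ≤ 1 / ((n : ℝ) + 1) := by
    rw [← ENNReal.ofReal_le_ofReal_iff (by positivity), ofReal_norm]
    refine le_trans (le_of_eq ?_) (h2 n)
    rw [Lp.enorm_def]
    refine eLpNorm_congr_ae ?_
    filter_upwards [Lp.coeFn_sub ((m2 n).toLp (gradient (φ n))) (grad (z n)),
      (m2 n).coeFn_toLp] with x e1 e2
    rw [e1, Pi.sub_apply, e2]
  have hn1 (n : ℕ) : 1 / ((n : ℝ) + 1) ≤ 1 := by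
    rw [div_le_one (by positivity)]; linarith [(Nat.cast_nonneg n : (0 : ℝ) ≤ n)]
  have b1 (n : ℕ) : ‖(m1 n).toLp (φ n)‖ ≤ 2 := by
    have := norm_le_norm_add_norm_sub' ((m1 n).toLp (φ n)) (fn (z n))
    linarith [d1 n, hn1 n, norm_fn_le (z n), hz n]
  have b2 (n : ℕ) : ‖(m2 n).toLp (gradient (φ n))‖ ≤ 2 := by
    have := norm_le_norm_add_norm_sub' ((m2 n).toLp (gradient (φ n))) (grad (z n))
    linarith [d2 n, hn1 n, norm_grad_le (z n), hz n]
  have hd : Tendsto (fun n => (m1 n).toLp (φ n) - fn (z n)) atTop (𝓝 0) :=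
    squeeze_zero_norm d1 tendsto_one_div_add_atTop_nhds_zero_nat
  have hR := tendsto_lintegral_sq_of_weakly_null hΩ hΩb hΩs hφ (M := 4) (fun n => by
      rw [← norm_toLp_sq (m1 n), ENNReal.ofReal_le_iff_le_toReal (by simp)]
      simp only [ENNReal.coe_ofNat, ENNReal.toReal_ofNat]
      nlinarith [norm_nonneg ((m1 n).toLp (φ n)), b1 n])
    (fun n => by
      rw [← norm_toLp_sq (m2 n), ENNReal.ofReal_le_iff_le_toReal (by simp)]
      simp only [ENNReal.coe_ofNat, ENNReal.toReal_ofNat]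
      nlinarith [norm_nonneg ((m2 n).toLp (gradient (φ n))), b2 n])
    (fun ψ hψ hψc => by
      have mψ := memLp_vol_of_continuous hΩ hΩb hψ
      have t1 := (hw (mψ.toLp ψ)).add
        ((tendsto_const_nhds (x := mψ.toLp ψ)).inner (𝕜 := ℝ) hd)
      rw [inner_zero_right, add_zero] at t1
      refine t1.congr fun n => ?_
      rw [← inner_add_right, add_sub_cancel, L2_inner_toLp]
      refine integral_congr_ae ?_
      filter_upwards [(m1 n).coeFn_toLp] with x hx
      rw [hx]; rfl)
  have hn : Tendsto (fun n => ‖(m1 n).toLp (φ n)‖) atTop (𝓝 0) := by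
    have h := (ENNReal.tendsto_toReal ENNReal.zero_ne_top).comp hR
    have h' : Tendsto (fun n => ‖(m1 n).toLp (φ n)‖ ^ 2) atTop (𝓝 0) := by
      refine h.congr fun n => ?_
      rw [Function.comp_apply, ← norm_toLp_sq (m1 n), ENNReal.toReal_ofReal (by positivity)]
    have := h'.sqrt
    simpa [Real.sqrt_sq] using this
  have hsum := hn.add (tendsto_zero_iff_norm_tendsto_zero.1 hd)
  rw [add_zero] at hsum
  refine squeeze_zero (fun n => norm_nonneg _) (fun n => ?_) hsum
  have := norm_sub_norm_le (fn (z n)) ((m1 n).toLp (φ n))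
  rw [norm_sub_rev] at this
  linarith

end Hilbert

section TestFunctions

variable {Ω : Set E3}

/-- `‖w‖ ^ (-α)` is integrable near the origin of `ℝ³` for `α < 3`. -/
theorem lintegral_ball_rpow_lt_top {α : ℝ} (hα : α < 3) (D : ℝ) :
    ∫⁻ w in Metric.ball (0 : E3) D, ENNReal.ofReal (‖w‖ ^ (-α)) < ⊤ := by
  have hI : Integrable (fun w : E3 => (Set.Iio D).indicator (fun r : ℝ => r ^ (-α)) ‖w‖) := by
    rw [integrable_fun_norm_addHaar]
    have h1 : IntervalIntegrable (fun r : ℝ => r ^ (2 - α)) volume 0 (max D 0) :=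
      intervalIntegral.intervalIntegrable_rpow' (by linarith)
    rw [intervalIntegrable_iff_integrableOn_Ioc_of_le (le_max_right _ _)] at h1
    have h2 : IntegrableOn ((Set.Iio D).indicator fun r : ℝ => r ^ (2 - α)) (Set.Ioi 0) := by
      rw [IntegrableOn, integrable_indicator_iff measurableSet_Iio, IntegrableOn,
        Measure.restrict_restrict measurableSet_Iio]
      refine h1.mono_set ?_
      rintro r ⟨hr1, hr2⟩
      exact ⟨hr2, (le_of_lt hr1).trans (le_max_left _ _)⟩
    refine h2.congr_fun (fun r hr => ?_) measurableSet_Ioi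
    by_cases h : r ∈ Set.Iio D
    · simp only [Set.indicator_of_mem h, smul_eq_mul, finrank_euclideanSpace, Fintype.card_fin]
      rw [sub_eq_add_neg, Real.rpow_add hr, ← Real.rpow_natCast]
      norm_num
    · simp [Set.indicator_of_notMem h]
  have h3 := hI.lintegral_lt_top
  refine lt_of_le_of_lt ?_ h3
  rw [← lintegral_indicator Metric.isOpen_ball.measurableSet]
  refine lintegral_mono fun w => ?_
  by_cases h : w ∈ Metric.ball (0 : E3) D
  · rw [Set.indicator_of_mem h, Set.indicator_of_mem (Set.mem_Iio.2 (mem_ball_zero_iff.1 h))]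
  · rw [Set.indicator_of_notMem h]; exact zero_le

/-- Test functions belong to `H^s(Ω)`: by the Lipschitz bound the square of the difference quotient
is at most a multiple of `|x - y| ^ (-(1 + 2 s))`, and `1 + 2 s < 3`. -/
theorem exists_Hs_of_test (hΩb : Bornology.IsBounded Ω) {s : ℝ} (hs' : s < 1) {ψ : E3 → ℝ}
    (hψ : ContDiff ℝ ∞ ψ) (hψc : HasCompactSupport ψ) :
    ∃ (m : MemLp ψ 2 (vol Ω)) (φ : Hs Ω s), fnHs φ = m.toLp ψ := by
  have m : MemLp ψ 2 (vol Ω) := hψ.continuous.memLp_of_hasCompactSupport hψc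
  obtain ⟨K, hK⟩ := hψ.lipschitzWith_of_hasCompactSupport hψc (by simp)
  obtain ⟨D, hD⟩ := Metric.isBounded_iff.1 hΩb
  set q : E3 × E3 → ℝ := fun z => (ψ z.1 - ψ z.2) / ‖z.1 - z.2‖ ^ (3 / 2 + s) with hq
  have hqm : Measurable q := by
    have : Measurable ψ := hψ.continuous.measurable
    fun_prop
  have hpt (x y : E3) : ‖q (x, y)‖ₑ ^ 2
      ≤ ENNReal.ofReal ((K : ℝ) ^ 2) * ENNReal.ofReal (‖x - y‖ ^ (-(1 + 2 * s))) := by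
    rw [← ENNReal.ofReal_mul (by positivity), ← ofReal_norm, ← ENNReal.ofReal_pow (norm_nonneg _)]
    apply ENNReal.ofReal_le_ofReal
    rcases eq_or_ne x y with rfl | hxy
    · simp [hq]; positivity
    have hr : 0 < ‖x - y‖ := norm_pos_iff.2 (sub_ne_zero.2 hxy)
    have h1 := hK.dist_le_mul x y
    rw [Real.dist_eq, dist_eq_norm] at h1
    set r := ‖x - y‖ with hr'
    have hp : (r ^ (3 / 2 + s)) ^ 2 = r ^ (3 + 2 * s) := by
      rw [← Real.rpow_natCast, ← Real.rpow_mul hr.le]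
      congr 1; push_cast; ring
    have hp2 : r ^ (-(1 + 2 * s)) * r ^ (3 + 2 * s) = r ^ 2 := by
      rw [← Real.rpow_add hr, ← Real.rpow_natCast]
      congr 1; push_cast; ring
    rw [hq, Real.norm_eq_abs, sq_abs, div_pow, ← hr', hp, div_le_iff₀ (by positivity), mul_assoc,
      hp2, ← mul_pow, ← sq_abs (ψ x - ψ y)]
    gcongr
  have hq2 : MemLp q 2 ((vol Ω).prod (vol Ω)) := by
    refine ⟨hqm.aestronglyMeasurable, ?_⟩
    have : eLpNorm q 2 ((vol Ω).prod (vol Ω)) ^ 2 < ⊤ := by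
      rw [eLpNorm_two_sq, lintegral_prod _ (hqm.enorm.pow_const 2).aemeasurable]
      set B := ∫⁻ w in Metric.ball (0 : E3) (D + 1), ENNReal.ofReal (‖w‖ ^ (-(1 + 2 * s))) with hB
      have hBt : B < ⊤ := lintegral_ball_rpow_lt_top (by linarith) _
      calc ∫⁻ x in Ω, ∫⁻ y in Ω, ‖q (x, y)‖ₑ ^ 2
          ≤ ∫⁻ _x in Ω, ENNReal.ofReal ((K : ℝ) ^ 2) * B := by
            refine lintegral_mono_ae ?_
            have hΩn : ∀ᵐ x ∂(vol Ω), x ∈ closure Ω := by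
              refine ae_restrict_of_ae_restrict_of_subset subset_closure ?_
              exact ae_restrict_mem isClosed_closure.measurableSet
            filter_upwards [hΩn] with x hx
            refine (lintegral_mono fun y => hpt x y).trans ?_
            rw [lintegral_const_mul _ (by fun_prop)]
            gcongr
            calc ∫⁻ y in Ω, ENNReal.ofReal (‖x - y‖ ^ (-(1 + 2 * s)))
                ≤ ∫⁻ y in Metric.ball x (D + 1), ENNReal.ofReal (‖x - y‖ ^ (-(1 + 2 * s))) := by
                  refine lintegral_mono_set fun y hy => ?_
                  have hcl : closure Ω ⊆ Metric.closedBall y D :=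
                    closure_minimal (fun w hw => hD hw hy) Metric.isClosed_closedBall
                  have := hcl hx
                  rw [Metric.mem_closedBall, dist_comm] at this
                  rw [Metric.mem_ball]; linarith
              _ = B := by
                  rw [hB, ← lintegral_indicator Metric.isOpen_ball.measurableSet,
                    ← lintegral_indicator Metric.isOpen_ball.measurableSet,
                    ← lintegral_sub_left_eq_self _ x]
                  refine lintegral_congr fun y => ?_
                  simp only [Set.indicator, Metric.mem_ball, dist_eq_norm, sub_zero,
                    sub_sub_cancel, sub_sub_cancel_left, norm_neg]
        _ = ENNReal.ofReal ((K : ℝ) ^ 2) * B * volume Ω := by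
            rw [lintegral_const, Measure.restrict_apply_univ]
        _ < ⊤ := ENNReal.mul_lt_top (ENNReal.mul_lt_top ENNReal.ofReal_lt_top hBt)
            hΩb.measure_lt_top
    rwa [ENNReal.pow_lt_top_iff, or_iff_left two_ne_zero] at this
  refine ⟨m, ⟨WithLp.toLp 2 (m.toLp ψ, hq2.toLp q), ?_⟩, rfl⟩
  have ha := Measure.quasiMeasurePreserving_fst (μ := vol Ω) (ν := vol Ω) |>.ae m.coeFn_toLp
  have hb := Measure.quasiMeasurePreserving_snd (μ := vol Ω) (ν := vol Ω) |>.ae m.coeFn_toLp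
  change _ =ᵐ[_] _
  filter_upwards [hq2.coeFn_toLp, ha, hb] with z h1 h2 h3
  simp only [WithLp.toLp_fst, WithLp.toLp_snd]
  rw [h1, h2, h3]

/-- The embedding of `H¹(Ω)` in `H^{-s}(Ω)` is injective, since `H^s(Ω)` contains the test
functions. -/
theorem fn_eq_zero_of_toHneg (hΩ : IsOpen Ω) (hΩb : Bornology.IsBounded Ω) {s : ℝ} (hs' : s < 1)
    {u : H1 Ω} (hu : toHneg s u = 0) : fn u = 0 := by
  have hloc : LocallyIntegrableOn (fn u) Ω (vol Ω) :=
    ((Lp.memLp (fn u)).locallyIntegrable (by norm_num)).locallyIntegrableOn _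
  have h := hΩ.ae_eq_zero_of_integral_contDiff_smul_eq_zero hloc fun ψ hψ hψc _ => by
    obtain ⟨m, φ, hφ⟩ := exists_Hs_of_test (Ω := Ω) hΩb hs' hψ hψc
    have h1 : toHneg s u φ = 0 := by rw [hu]; rfl
    have h2 : toHneg s u φ = ⟪fn u, fnHs φ⟫ := rfl
    rw [h2, hφ, real_inner_comm, L2_inner_toLp] at h1
    rw [← h1]
    refine integral_congr_ae (Eventually.of_forall fun x => ?_)
    simp [mul_comm]
  rw [Lp.eq_zero_iff_ae_eq_zero]
  filter_upwards [h, ae_restrict_mem hΩ.measurableSet] with x hx hxΩ using hx hxΩ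

end TestFunctions

/-! ### The nonlinear terms and the linearization -/

section Nonlinearity

/-- What the `C²` bounds on `j` give: `j` is bounded and Lipschitz, and its first order Taylor
remainder is both quadratic and at most linear in the increment. -/
theorem IsAdmissible.exists_bounds {j : ℝ → ℝ} (hj : IsAdmissible j) :
    ∃ K : ℝ, 0 < K ∧ Continuous j ∧ Continuous (deriv j) ∧ (∀ p, |j p| ≤ K) ∧
      (∀ p, |deriv j p| ≤ K) ∧ (∀ p q, |j (p + q) - j p| ≤ K * |q|) ∧
      ∀ p q, |j (p + q) - j p - deriv j p * q| ≤ |q| * min (2 * K) (K * |q|) := by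
  obtain ⟨K, hK, h⟩ := hj.bounded
  have h0 (p : ℝ) : |j p| ≤ K := by
    linarith [h p, abs_nonneg (deriv j p), abs_nonneg (deriv (deriv j) p)]
  have h1 (p : ℝ) : |deriv j p| ≤ K := by
    linarith [h p, abs_nonneg (j p), abs_nonneg (deriv (deriv j) p)]
  have h2 (p : ℝ) : |deriv (deriv j) p| ≤ K := by
    linarith [h p, abs_nonneg (j p), abs_nonneg (deriv j p)]
  have hd : Differentiable ℝ j := hj.contDiff.differentiable (by norm_num)
  have hd1 : ContDiff ℝ 1 (deriv j) :=
    (contDiff_succ_iff_deriv (n := 1).1 (by exact_mod_cast hj.contDiff)).2.2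
  have hd' : Differentiable ℝ (deriv j) := hd1.differentiable (by norm_num)
  have l0 (p q : ℝ) : |j (p + q) - j p| ≤ K * |q| := by
    have := convex_univ.norm_image_sub_le_of_norm_deriv_le (f := j) (x := p) (y := p + q) (C := K)
      (fun x _ => hd x) (fun x _ => h1 x) trivial trivial
    simpa using this
  have l1 (p q : ℝ) : |deriv j (p + q) - deriv j p| ≤ K * |q| := by
    have := convex_univ.norm_image_sub_le_of_norm_deriv_le (f := deriv j) (x := p) (y := p + q)
      (C := K) (fun x _ => hd' x) (fun x _ => h2 x) trivial trivial
    simpa using this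
  refine ⟨K, hK, hd.continuous, hd'.continuous, h0, h1, l0, fun p q => ?_⟩
  rw [mul_min_of_nonneg _ _ (abs_nonneg q)]
  refine le_min ?_ ?_
  · have a1 := abs_sub (j (p + q) - j p) (deriv j p * q)
    have a2 : |deriv j p * q| ≤ K * |q| := by rw [abs_mul]; gcongr; exact h1 p
    linarith [l0 p q]
  · have hder (t : ℝ) : HasDerivAt (fun t => j (p + t) - deriv j p * t)
        (deriv j (p + t) - deriv j p) t := by
      have := ((hd (p + t)).hasDerivAt.comp_const_add p t).sub
        ((hasDerivAt_id t).const_mul (deriv j p))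
      rw [mul_one] at this
      exact this
    have := (convex_closedBall (0 : ℝ) |q|).norm_image_sub_le_of_norm_deriv_le
      (f := fun t => j (p + t) - deriv j p * t) (x := 0) (y := q) (C := K * |q|)
      (fun t _ => (hder t).differentiableAt) (fun t ht => ?_)
      (Metric.mem_closedBall_self (abs_nonneg q)) (by simp)
    · simp only [add_zero, mul_zero, sub_zero, Real.norm_eq_abs] at this
      rw [show j (p + q) - j p - deriv j p * q = j (p + q) - deriv j p * q - j p by ring]
      linarith
    · rw [(hder t).deriv, Real.norm_eq_abs]
      refine (l1 p t).trans ?_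
      rw [mem_closedBall_zero_iff, Real.norm_eq_abs] at ht
      gcongr

variable {α : Type*} [MeasurableSpace α] {μ : Measure α}

theorem integral_mul_le_norm_mul_norm {p q : α → ℝ} (hp : MemLp p 2 μ) (hq : MemLp q 2 μ) :
    ∫ x, p x * q x ∂μ ≤ ‖hp.toLp p‖ * ‖hq.toLp q‖ := by
  refine le_trans (le_of_eq ?_) (real_inner_le_norm (hp.toLp p) (hq.toLp q))
  rw [L2_inner_toLp]
  refine integral_congr_ae ?_
  filter_upwards [hq.coeFn_toLp] with x hx
  rw [hx]; simp [mul_comm]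

theorem norm_toLp_abs (q : Lp ℝ 2 μ) :
    ‖(Lp.memLp q).norm.toLp fun x => ‖q x‖‖ = ‖q‖ := by
  rw [Lp.norm_toLp, eLpNorm_norm, ← Lp.norm_def]

/-- Integration against a bounded multiple of a fixed `L²` function is a continuous functional. -/
theorem exists_functional {m : α → ℝ} {K : ℝ} (hm : AEStronglyMeasurable m μ)
    (hK : ∀ᵐ x ∂μ, |m x| ≤ K) {F : Type*} [NormedAddCommGroup F] [InnerProductSpace ℝ F]
    (r : Lp F 2 μ) :
    ∃ T : Lp F 2 μ →L[ℝ] ℝ, ∀ q : Lp F 2 μ, T q = ∫ x, m x * ⟪q x, r x⟫ ∂μ := by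
  have h : MemLp (fun x => m x • r x) 2 μ :=
    (Lp.memLp r).smul (memLp_top_of_bound hm K hK)
  refine ⟨innerSL ℝ (h.toLp _), fun q => ?_⟩
  rw [innerSL_apply_apply, L2_inner_toLp]
  refine integral_congr_ae (Eventually.of_forall fun x => ?_)
  simp only [real_inner_smul_left]
  rw [real_inner_comm]

variable [IsFiniteMeasure μ]

theorem integrable_comp_mul {j : ℝ → ℝ} (hj : Continuous j) {K : ℝ} (hK : ∀ p, |j p| ≤ K)
    (p r : Lp ℝ 2 μ) : Integrable (fun x => j (p x) * r x) μ :=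
  ((Lp.memLp r).integrable (by norm_num)).bdd_mul
    (hj.comp_aestronglyMeasurable (Lp.aestronglyMeasurable p))
    (Eventually.of_forall fun x => hK _)

theorem integral_comp_add_sub {j : ℝ → ℝ} (hj : Continuous j) {K : ℝ} (hK : ∀ p, |j p| ≤ K)
    (p q r : Lp ℝ 2 μ) :
    (∫ x, j ((p + q : Lp ℝ 2 μ) x) * r x ∂μ) - ∫ x, j (p x) * r x ∂μ
      = ∫ x, (j (p x + q x) - j (p x)) * r x ∂μ := by
  rw [← integral_sub (integrable_comp_mul hj hK _ _) (integrable_comp_mul hj hK _ _)]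
  refine integral_congr_ae ?_
  filter_upwards [Lp.coeFn_add p q] with x hx
  rw [hx, Pi.add_apply]; ring

/-- The superposition operator is Lipschitz. -/
theorem integral_comp_sub_le {j : ℝ → ℝ} (hj : IsAdmissible j) :
    ∃ K : ℝ, 0 < K ∧ ∀ p q r : Lp ℝ 2 μ,
      (∫ x, j ((p + q : Lp ℝ 2 μ) x) * r x ∂μ) - ∫ x, j (p x) * r x ∂μ ≤ K * ‖q‖ * ‖r‖ := by
  obtain ⟨K, hK, hc, -, h0, -, hl, -⟩ := hj.exists_bounds
  refine ⟨K, hK, fun p q r => ?_⟩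
  rw [integral_comp_add_sub hc h0]
  have hi : Integrable (fun x => (j (p x + q x) - j (p x)) * r x) μ := by
    refine ((Lp.memLp r).integrable (by norm_num)).bdd_mul (c := 2 * K) ?_
      (Eventually.of_forall fun x => ?_)
    · exact (hc.comp_aestronglyMeasurable ((Lp.aestronglyMeasurable p).add
        (Lp.aestronglyMeasurable q))).sub (hc.comp_aestronglyMeasurable (Lp.aestronglyMeasurable p))
    · rw [Real.norm_eq_abs]
      have := abs_sub (j (p x + q x)) (j (p x))
      linarith [h0 (p x + q x), h0 (p x)]
  have hqr : Integrable (fun x => ‖q x‖ * ‖r x‖) μ := (Lp.memLp q).norm.integrable_mul (Lp.memLp r).norm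
  calc ∫ x, (j (p x + q x) - j (p x)) * r x ∂μ ≤ ∫ x, K * (‖q x‖ * ‖r x‖) ∂μ := by
        refine integral_mono hi (hqr.const_mul K) fun x => ?_
        refine (le_abs_self _).trans ?_
        rw [abs_mul, ← mul_assoc]
        exact mul_le_mul_of_nonneg_right (hl _ _) (abs_nonneg _)
    _ = K * ∫ x, ‖q x‖ * ‖r x‖ ∂μ := integral_const_mul _ _
    _ ≤ K * (‖q‖ * ‖r‖) := by
        gcongr
        have := integral_mul_le_norm_mul_norm (Lp.memLp q).norm (Lp.memLp r).norm
        rwa [norm_toLp_abs, norm_toLp_abs] at this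
    _ = _ := by ring

/-- The superposition operator is differentiable when tested against a fixed function: the remainder is
`o(ρₙ)` if the increments tend to zero in `L²` and are `O(ρₙ)`. -/
theorem tendsto_remainder_div {j : ℝ → ℝ} (hj : IsAdmissible j) (p r : Lp ℝ 2 μ)
    {q : ℕ → Lp ℝ 2 μ} {ρ : ℕ → ℝ} {M : ℝ} (hρ : ∀ n, 0 < ρ n) (hq : Tendsto q atTop (𝓝 0))
    (hqρ : ∀ n, ‖q n‖ ≤ M * ρ n) :
    Tendsto (fun n => ((∫ x, j ((p + q n : Lp ℝ 2 μ) x) * r x ∂μ) - (∫ x, j (p x) * r x ∂μ)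
      - ∫ x, deriv j (p x) * q n x * r x ∂μ) / ρ n) atTop (𝓝 0) := by
  obtain ⟨K, hK, hc, hc', h0, h1, -, hl⟩ := hj.exists_bounds
  -- the bounded factor that tends to zero
  set m : ℝ → ℝ := fun t => min (2 * K) (K * |t|) with hm
  have hmc : Continuous m := by fun_prop
  have hm0 (t : ℝ) : 0 ≤ m t := le_min (by positivity) (by positivity)
  have hmK (t : ℝ) : m t ≤ 2 * K := min_le_left _ _
  have hmm (n : ℕ) : AEStronglyMeasurable (fun x => m (q n x)) μ :=
    hmc.comp_aestronglyMeasurable (Lp.aestronglyMeasurable _)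
  have hmr (n : ℕ) : MemLp (fun x => m (q n x) * ‖r x‖) 2 μ :=
    (Lp.memLp r).norm.mul (memLp_top_of_bound (hmm n) (2 * K)
      (Eventually.of_forall fun x => by rw [Real.norm_of_nonneg (hm0 _)]; exact hmK _))
  have hsq (n : ℕ) : ‖(hmr n).toLp _‖ ^ 2 = ∫ x, (m (q n x) * ‖r x‖) ^ 2 ∂μ := by
    rw [← real_inner_self_eq_norm_sq, L2_inner_toLp]
    refine integral_congr_ae ?_
    filter_upwards [(hmr n).coeFn_toLp] with x hx
    rw [hx]; simp only [sq]; rfl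
  have hr2 : Integrable (fun x => ‖r x‖ ^ 2) μ := (Lp.memLp r).integrable_norm_pow (by norm_num)
  have hlim : Tendsto (fun n => ∫ x, (m (q n x) * ‖r x‖) ^ 2 ∂μ) atTop (𝓝 0) := by
    -- dominated convergence along subsequences that converge almost everywhere
    refine tendsto_of_subseq_tendsto fun ns hns => ?_
    obtain ⟨ms, -, hms⟩ := (tendstoInMeasure_of_tendsto_Lp (hq.comp hns)).exists_seq_tendsto_ae
    refine ⟨ms, ?_⟩
    have : Tendsto (fun i => ∫ x, (m (q (ns (ms i)) x) * ‖r x‖) ^ 2 ∂μ) atTop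
        (𝓝 (∫ _x, (0 : ℝ) ∂μ)) := by
      refine tendsto_integral_of_dominated_convergence (fun x => (2 * K) ^ 2 * ‖r x‖ ^ 2)
        (fun i => ((hmm _).mul (Lp.aestronglyMeasurable r).norm).pow 2) (hr2.const_mul _)
        (fun i => Eventually.of_forall fun x => ?_) ?_
      · rw [Real.norm_of_nonneg (sq_nonneg _), mul_pow]
        gcongr
        exact hmK _
      · filter_upwards [hms, Lp.coeFn_zero ℝ 2 μ] with x hx hx0
        rw [hx0, Pi.zero_apply] at hx
        have h2 := (((hmc.tendsto 0).comp hx).mul_const ‖r x‖).pow 2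
        simpa [hm, hK.le] using h2
    simpa using this
  have hlim' : Tendsto (fun n => ‖(hmr n).toLp _‖) atTop (𝓝 0) := by
    have := hlim.sqrt
    simp only [← hsq] at this
    simpa [Real.sqrt_sq] using this
  have hbound (n : ℕ) : ‖((∫ x, j ((p + q n : Lp ℝ 2 μ) x) * r x ∂μ) - (∫ x, j (p x) * r x ∂μ)
      - ∫ x, deriv j (p x) * q n x * r x ∂μ) / ρ n‖ ≤ M * ‖(hmr n).toLp _‖ := by
    rw [norm_div, Real.norm_of_nonneg (hρ n).le, div_le_iff₀ (hρ n)]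
    have hqr : Integrable (fun x => q n x * r x) μ := (Lp.memLp (q n)).integrable_mul (Lp.memLp r)
    have i1 : Integrable (fun x => deriv j (p x) * q n x * r x) μ := by
      simp only [mul_assoc]
      exact hqr.bdd_mul (hc'.comp_aestronglyMeasurable (Lp.aestronglyMeasurable p))
        (Eventually.of_forall fun x => h1 _)
    have i2 : Integrable (fun x => (j (p x + q n x) - j (p x)) * r x) μ := by
      refine ((integrable_comp_mul hc h0 (p + q n) r).sub (integrable_comp_mul hc h0 p r)).congr ?_
      filter_upwards [Lp.coeFn_add p (q n)] with x hx
      simp only [Pi.sub_apply, hx, Pi.add_apply]; ring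
    have i3 : Integrable (fun x => ‖q n x‖ * (m (q n x) * ‖r x‖)) μ :=
      (Lp.memLp (q n)).norm.integrable_mul (hmr n)
    rw [integral_comp_add_sub hc h0, ← integral_sub i2 i1]
    calc ‖∫ x, ((j (p x + q n x) - j (p x)) * r x - deriv j (p x) * q n x * r x) ∂μ‖
        ≤ ∫ x, ‖(j (p x + q n x) - j (p x)) * r x - deriv j (p x) * q n x * r x‖ ∂μ :=
          norm_integral_le_integral_norm _
      _ ≤ ∫ x, ‖q n x‖ * (m (q n x) * ‖r x‖) ∂μ := by
          refine integral_mono (i2.sub i1).norm i3 fun x => ?_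
          simp only
          rw [← sub_mul, norm_mul, ← mul_assoc]
          exact mul_le_mul_of_nonneg_right (hl _ _) (norm_nonneg _)
      _ ≤ ‖q n‖ * ‖(hmr n).toLp _‖ := by
          have := integral_mul_le_norm_mul_norm (Lp.memLp (q n)).norm (hmr n)
          rwa [norm_toLp_abs] at this
      _ ≤ M * ρ n * ‖(hmr n).toLp _‖ := by gcongr; exact hqρ n
      _ = _ := by ring
  exact squeeze_zero_norm hbound (by simpa using hlim'.const_mul M)

end Nonlinearity

section Forms

variable {Ω : Set E3}

theorem aestronglyMeasurable_coeff (hΩ : IsOpen Ω) {a : E3 → ℝ}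
    (ha : ContDiffOn ℝ 1 a (closure Ω)) : AEStronglyMeasurable a (vol Ω) :=
  (ha.continuousOn.mono subset_closure).aestronglyMeasurable hΩ.measurableSet

theorem ae_coeff (hΩ : IsOpen Ω) {a : E3 → ℝ} {a₀ a₁ : ℝ}
    (hab : ∀ x ∈ closure Ω, a₀ ≤ a x ∧ a x ≤ a₁) : ∀ᵐ x ∂(vol Ω), a₀ ≤ a x ∧ a x ≤ a₁ := by
  filter_upwards [ae_restrict_mem hΩ.measurableSet] with x hx using hab x (subset_closure hx)

theorem exists_lamPair_functional (hΩ : IsOpen Ω) {a : E3 → ℝ} (ha : ContDiffOn ℝ 1 a (closure Ω))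
    {a₀ a₁ : ℝ} (ha₀ : 0 < a₀) (hab : ∀ x ∈ closure Ω, a₀ ≤ a x ∧ a x ≤ a₁) (v : H1 Ω) :
    ∃ T : H1 Ω →L[ℝ] ℝ, ∀ u, T u = lamPair a u v := by
  obtain ⟨T₁, h₁⟩ := exists_functional (K := a₁) (aestronglyMeasurable_coeff hΩ ha)
    (by filter_upwards [ae_coeff hΩ hab] with x hx; rw [abs_of_pos (ha₀.trans_le hx.1)]; exact hx.2)
    (grad v)
  refine ⟨T₁.comp (gradL Ω) + (innerSL ℝ (fn v)).comp (fnL Ω), fun u => ?_⟩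
  rw [add_apply, ContinuousLinearMap.comp_apply,
    ContinuousLinearMap.comp_apply, h₁, innerSL_apply_apply, lamPair, L2.inner_def]
  rfl

theorem exists_DF0Pair_functional (hΩ : IsOpen Ω) (hΩb : Bornology.IsBounded Ω)
    (hΩs : HasSmoothBoundary Ω) {f g : ℝ → ℝ} (hf : IsAdmissible f) (hg : IsAdmissible g)
    (u₀ v : H1 Ω) : ∃ T : H1 Ω →L[ℝ] ℝ, ∀ u, T u = DF0Pair f g u₀ u v := by
  obtain ⟨Kf, -, -, hfc, -, hf1, -, -⟩ := hf.exists_bounds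
  obtain ⟨Kg, -, -, hgc, -, hg1, -, -⟩ := hg.exists_bounds
  obtain ⟨γ, hγ⟩ := exists_traceL hΩ hΩb hΩs
  obtain ⟨T₁, h₁⟩ := exists_functional (μ := vol Ω) (K := Kf)
    (hfc.comp_aestronglyMeasurable (Lp.aestronglyMeasurable (fn u₀)))
    (Eventually.of_forall fun x => hf1 _) (fn v)
  obtain ⟨T₂, h₂⟩ := exists_functional (μ := surface Ω) (K := Kg)
    (hgc.comp_aestronglyMeasurable (Lp.aestronglyMeasurable (trace u₀)))
    (Eventually.of_forall fun x => hg1 _) (trace v)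
  refine ⟨T₁.comp (fnL Ω) + T₂.comp γ, fun u => ?_⟩
  rw [add_apply, ContinuousLinearMap.comp_apply,
    ContinuousLinearMap.comp_apply, h₁, h₂, DF0Pair, hγ, fnL_apply]
  congr 1 <;>
  · refine integral_congr_ae (Eventually.of_forall fun x => ?_)
    simp [mul_comm, mul_left_comm]

/-- Ellipticity of `Λ` on `H¹(Ω)`. -/
theorem lamPair_self_ge (hΩ : IsOpen Ω) {a : E3 → ℝ} (ha : ContDiffOn ℝ 1 a (closure Ω))
    {a₀ a₁ : ℝ} (ha₀ : 0 < a₀) (hab : ∀ x ∈ closure Ω, a₀ ≤ a x ∧ a x ≤ a₁) (u : H1 Ω) :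
    min a₀ 1 * ‖u‖ ^ 2 ≤ lamPair a u u := by
  have hg : ‖grad u‖ ^ 2 = ∫ x in Ω, ⟪grad u x, grad u x⟫ := by
    rw [← real_inner_self_eq_norm_sq, L2.inner_def]
  have hf : ‖fn u‖ ^ 2 = ∫ x in Ω, fn u x * fn u x := by
    rw [← real_inner_self_eq_norm_sq, L2.inner_def]
    rfl
  have hi : Integrable (fun x => ⟪grad u x, grad u x⟫) (vol Ω) := L2.integrable_inner _ _
  have h1 : a₀ * ‖grad u‖ ^ 2 ≤ ∫ x in Ω, a x * ⟪grad u x, grad u x⟫ := by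
    rw [hg, ← integral_const_mul]
    refine integral_mono_ae (hi.const_mul _) (hi.bdd_mul (c := a₁)
      (aestronglyMeasurable_coeff hΩ ha) ?_) ?_
    · filter_upwards [ae_coeff hΩ hab] with x hx
      rw [Real.norm_of_nonneg (ha₀.le.trans hx.1)]
      exact hx.2
    · filter_upwards [ae_coeff hΩ hab] with x hx
      exact mul_le_mul_of_nonneg_right hx.1 real_inner_self_nonneg
  rw [lamPair, ← hf, norm_sq_H1, mul_add]
  have h2 := mul_le_mul_of_nonneg_right (min_le_right a₀ 1) (sq_nonneg ‖fn u‖)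
  have h3 := mul_le_mul_of_nonneg_right (min_le_left a₀ 1) (sq_nonneg ‖grad u‖)
  linarith

/-- The equation satisfied by the difference of two solutions. -/
theorem lamPair_increment (hΩ : IsOpen Ω) {a : E3 → ℝ} (ha : ContDiffOn ℝ 1 a (closure Ω))
    {a₀ a₁ : ℝ} (ha₀ : 0 < a₀) (hab : ∀ x ∈ closure Ω, a₀ ≤ a x ∧ a x ≤ a₁) {f g : ℝ → ℝ}
    {γ : H1 Ω →L[ℝ] Lp ℝ 2 (surface Ω)} (hγ : ∀ u, γ u = trace u) {u₀ w : H1 Ω}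
    (hu₀ : u₀ ∈ equilibria Ω a f g) (hw : u₀ + w ∈ equilibria Ω a f g) (v : H1 Ω) :
    lamPair a w v
      = ((∫ x in Ω, f ((fn u₀ + fn w : Lp ℝ 2 (vol Ω)) x) * fn v x)
          - ∫ x in Ω, f (fn u₀ x) * fn v x)
        + ((∫ x, g ((trace u₀ + γ w : Lp ℝ 2 (surface Ω)) x) * trace v x ∂(surface Ω))
          - ∫ x, g (trace u₀ x) * trace v x ∂(surface Ω)) := by
  obtain ⟨T, hT⟩ := exists_lamPair_functional hΩ ha ha₀ hab v
  have h1 := hw v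
  have h2 := hu₀ v
  have h3 : trace (u₀ + w) = trace u₀ + γ w := by rw [← hγ, ← hγ, map_add]
  rw [← hT, map_add, hT, hT, h2, F0Pair, F0Pair, h3, fn_add] at h1
  linarith

/-- Along solutions `u₀ + wₙ → u₀`, the linearized equation holds asymptotically for the normalized
increments `wₙ / ‖wₙ‖`. -/
theorem tendsto_linearized_div (hΩ : IsOpen Ω) (hΩb : Bornology.IsBounded Ω)
    (hΩs : HasSmoothBoundary Ω) {a : E3 → ℝ} (ha : ContDiffOn ℝ 1 a (closure Ω))
    {a₀ a₁ : ℝ} (ha₀ : 0 < a₀) (hab : ∀ x ∈ closure Ω, a₀ ≤ a x ∧ a x ≤ a₁) {f g : ℝ → ℝ}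
    (hf : IsAdmissible f) (hg : IsAdmissible g) {u₀ : H1 Ω} (hu₀ : u₀ ∈ equilibria Ω a f g)
    {w : ℕ → H1 Ω} (hwE : ∀ n, u₀ + w n ∈ equilibria Ω a f g) (hw0 : ∀ n, w n ≠ 0)
    (hw : Tendsto w atTop (𝓝 0)) (v : H1 Ω) :
    Tendsto (fun n => (lamPair a (w n) v - DF0Pair f g u₀ (w n) v) / ‖w n‖) atTop (𝓝 0) := by
  have := isFiniteMeasure_vol hΩb
  have := isFiniteMeasure_surface hΩ hΩb hΩs
  obtain ⟨γ, hγ⟩ := exists_traceL hΩ hΩb hΩs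
  have t1 : Tendsto (fun n => fn (w n)) atTop (𝓝 0) := by
    have := ((fnL Ω).continuous.tendsto 0).comp hw
    rw [map_zero] at this
    exact this
  have t2 : Tendsto (fun n => γ (w n)) atTop (𝓝 0) := by
    have := (γ.continuous.tendsto 0).comp hw
    rw [map_zero] at this
    exact this
  have r1 := tendsto_remainder_div hf (fn u₀) (fn v) (M := 1) (fun n => norm_pos_iff.2 (hw0 n)) t1
    (fun n => by rw [one_mul]; exact norm_fn_le _)
  have r2 := tendsto_remainder_div hg (trace u₀) (trace v) (M := ‖γ‖)
    (fun n => norm_pos_iff.2 (hw0 n)) t2 (fun n => γ.le_opNorm _)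
  have r := r1.add r2
  rw [add_zero] at r
  refine r.congr fun n => ?_
  rw [lamPair_increment hΩ ha ha₀ hab hγ hu₀ (hwE n) v, DF0Pair, ← hγ (w n), ← add_div]
  congr 1
  ring

/-- If `0` is not in the spectrum, the linearized equation has no solution in `H¹(Ω)` but zero. -/
theorem fn_eq_zero_of_linearized (hΩ : IsOpen Ω) (hΩb : Bornology.IsBounded Ω) {s : ℝ} (hs' : s < 1)
    {a : E3 → ℝ} {f g : ℝ → ℝ} {u₀ : H1 Ω}
    (hspec : (0 : ℝ) ∉ spectralPoints (linearizedGraph Ω s a f g u₀)) {ζ : H1 Ω}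
    (hζ : ∀ v, lamPair a ζ v - DF0Pair f g u₀ ζ v = 0) : fn ζ = 0 := by
  rw [spectralPoints, Set.notMem_compl_iff] at hspec
  obtain ⟨R, hR⟩ := hspec
  refine fn_eq_zero_of_toHneg hΩ hΩb hs' ?_
  have h1 : (toHneg s ζ, (0 : Hneg Ω s)) ∈ linearizedGraph Ω s a f g u₀ :=
    ⟨ζ, rfl, fun v φ _ => by rw [hζ v]; rfl⟩
  have h2 := (hR _ _).1 h1
  rwa [zero_smul, sub_zero, map_zero] at h2

/-- The energy estimate for the difference of two solutions. -/
theorem exists_energy_bound (hΩ : IsOpen Ω) (hΩb : Bornology.IsBounded Ω)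
    (hΩs : HasSmoothBoundary Ω) {a : E3 → ℝ} (ha : ContDiffOn ℝ 1 a (closure Ω))
    {a₀ a₁ : ℝ} (ha₀ : 0 < a₀) (hab : ∀ x ∈ closure Ω, a₀ ≤ a x ∧ a x ≤ a₁) {f g : ℝ → ℝ}
    (hf : IsAdmissible f) (hg : IsAdmissible g) {u₀ : H1 Ω} (hu₀ : u₀ ∈ equilibria Ω a f g) :
    ∃ c D : ℝ, 0 < c ∧ ∀ w : H1 Ω, u₀ + w ∈ equilibria Ω a f g →
      c * ‖w‖ ^ 2 ≤ D * ‖fn w‖ ^ 2 := by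
  have := isFiniteMeasure_vol hΩb
  have := isFiniteMeasure_surface hΩ hΩb hΩs
  obtain ⟨γ, hγ⟩ := exists_traceL hΩ hΩb hΩs
  obtain ⟨Kf, hKf, hFf⟩ := integral_comp_sub_le (μ := vol Ω) hf
  obtain ⟨Kg, hKg, hFg⟩ := integral_comp_sub_le (μ := surface Ω) hg
  set c := min a₀ 1 with hc
  have hc0 : 0 < c := lt_min ha₀ one_pos
  -- the gradient part of the boundary term is absorbed by half of the ellipticity constant
  obtain ⟨C, hC0, hC⟩ := exists_norm_trace_sq_le hΩ hΩb hΩs (ε := c / (2 * Kg)) (by positivity)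
  refine ⟨c / 2, Kf + Kg * C, by positivity, fun w hw => ?_⟩
  have h1 := lamPair_self_ge hΩ ha ha₀ hab w
  rw [lamPair_increment hΩ ha ha₀ hab hγ hu₀ hw w] at h1
  have hb1 := hFf (fn u₀) (fn w) (fn w)
  have hb2 := hFg (trace u₀) (γ w) (trace w)
  rw [hγ] at hb2 h1
  have h5 := mul_le_mul_of_nonneg_left (hC w) hKg.le
  have h7 : Kg * (c / (2 * Kg) * ‖grad w‖ ^ 2) = c / 2 * ‖grad w‖ ^ 2 := by field_simp
  have h8 : c / 2 * ‖grad w‖ ^ 2 ≤ c / 2 * ‖w‖ ^ 2 := by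
    gcongr
    exact norm_grad_le w
  linarith

end Forms

end ConcentratedWave

open ConcentratedWave in
theorem theorem5p2
    (Ω : Set E3) (hΩ : IsOpen Ω) (hΩb : Bornology.IsBounded Ω) (hΩs : HasSmoothBoundary Ω)
    (a : E3 → ℝ) (ha : ContDiffOn ℝ 1 a (closure Ω))
    (a₀ a₁ : ℝ) (ha₀ : 0 < a₀) (ha₁ : 0 < a₁) (hab : ∀ x ∈ closure Ω, a₀ ≤ a x ∧ a x ≤ a₁)
    (f g : ℝ → ℝ) (hf : IsAdmissible f) (hg : IsAdmissible g)
    (s : ℝ) (hs : 1 / 2 < s) (hs' : s < 1)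
    (u₀ : H1 Ω) (hu₀ : u₀ ∈ equilibria Ω a f g)
    (hspec : (0 : ℝ) ∉ spectralPoints (linearizedGraph Ω s a f g u₀)) :
    ∃ r : ℝ, 0 < r ∧ equilibria Ω a f g ∩ Metric.closedBall u₀ r = {u₀} := by
  have := completeSpace_H1 (Ω := Ω)
  have := separableSpace_H1 (Ω := Ω)
  by_contra! hcon
  -- a sequence of solutions `u₀ + wₙ` different from `u₀` and converging to it
  have hex (n : ℕ) : ∃ w : H1 Ω, u₀ + w ∈ equilibria Ω a f g ∧ w ≠ 0 ∧ ‖w‖ ≤ 1 / ((n : ℝ) + 1) := by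
    have h := hcon (1 / ((n : ℝ) + 1)) (by positivity)
    by_contra! hno
    refine h (Set.Subset.antisymm ?_ ?_)
    · rintro u ⟨hu, hur⟩
      by_contra hne
      have := hno (u - u₀) (by rwa [add_sub_cancel]) (sub_ne_zero.2 hne)
      rw [Metric.mem_closedBall, dist_eq_norm] at hur
      linarith
    · rintro u rfl
      exact ⟨hu₀, Metric.mem_closedBall_self (by positivity)⟩
  choose w hwE hw0 hwn using hex
  have hρ (n : ℕ) : 0 < ‖w n‖ := norm_pos_iff.2 (hw0 n)
  have hwlim : Tendsto w atTop (𝓝 0) :=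
    squeeze_zero_norm hwn tendsto_one_div_add_atTop_nhds_zero_nat
  have hz1 (n : ℕ) : ‖‖w n‖⁻¹ • w n‖ = 1 := by
    rw [norm_smul, norm_inv, norm_norm]
    exact inv_mul_cancel₀ (hρ n).ne'
  obtain ⟨ζ, ns, hns, hweak⟩ := exists_weak_limit (fun n => ‖w n‖⁻¹ • w n) (M := 1)
    fun n => (hz1 n).le
  -- the weak limit of the normalized increments solves the linearized equation
  have hker (v : H1 Ω) : lamPair a ζ v - DF0Pair f g u₀ ζ v = 0 := by
    obtain ⟨T, hT⟩ := exists_lamPair_functional hΩ ha ha₀ hab v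
    obtain ⟨S, hS⟩ := exists_DF0Pair_functional hΩ hΩb hΩs hf hg u₀ v
    have l2 := (tendsto_linearized_div hΩ hΩb hΩs ha ha₀ hab hf hg hu₀ hwE hw0 hwlim v).comp
      hns.tendsto_atTop
    have e1 (u : H1 Ω) : (T - S) u = lamPair a u v - DF0Pair f g u₀ u v := by
      rw [sub_apply, hT, hS]
    rw [← e1]
    refine tendsto_nhds_unique (hweak (T - S)) (l2.congr fun n => ?_)
    rw [Function.comp_apply, map_smul, e1, smul_eq_mul, div_eq_inv_mul]
  have hζ := fn_eq_zero_of_linearized hΩ hΩb hs' hspec hker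
  have hstrong : Tendsto (fun n => ‖fn (‖w (ns n)‖⁻¹ • w (ns n))‖) atTop (𝓝 0) := by
    refine tendsto_norm_fn_of_weakly_null hΩ hΩb hΩs (fun n => (hz1 _).le) fun ψ => ?_
    have h := hweak ((innerSL ℝ ψ).comp (fnL Ω))
    have e2 (u : H1 Ω) : ((innerSL ℝ ψ).comp (fnL Ω)) u = ⟪ψ, fn u⟫ := rfl
    simp only [e2] at h
    rwa [hζ, inner_zero_right] at h
  -- by the energy estimate the normalized increments tend to zero in norm as well
  obtain ⟨c, D, hc, hD⟩ := exists_energy_bound hΩ hΩb hΩs ha ha₀ hab hf hg hu₀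
  have henergy (n : ℕ) : c ≤ D * ‖fn (‖w n‖⁻¹ • w n)‖ ^ 2 := by
    have h := hD (w n) (hwE n)
    rw [fn_smul, norm_smul, norm_inv, norm_norm, mul_pow, inv_pow, ← mul_assoc, mul_comm D,
      mul_assoc, ← div_eq_inv_mul, le_div_iff₀ (pow_pos (hρ n) 2)]
    exact h
  have hlim := ge_of_tendsto' ((hstrong.pow 2).const_mul D) fun n => henergy (ns n)
  norm_num at hlim
  linarith
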